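/- \textbf{Setting.} Let $G=(V,E)$ be a finite simple graph with $n=|V|\ge 1$ vertices and adjacency matrix $\mathbf A$ (in particular, $G$ may be a triangular lattice graph). Fix a set $T$ of triangles of $G$ (given as vertex sets $\tau$) such that every vertex lies in some $\tau\in T$, for each $v\in V$ a neighbour $u=u(v)$ of $v$, and for each $v\in V$ an angle $0\le\theta_v\le\pi/2$. Put $N_G=3|V|+|T|$. For operators $M_v$ and a bit string $x$ write $M^x=\bigotimes_v M_v^{x_v}$; exponents such as $\mathbf A1_v$, $\mathbf A\tau$ and $\mathbf A1_u\oplus 1_v$ are bit strings (modulo $2$), where $\tau$ also denotes the characteristic vector of the triangle. \textbf{Provers.} A set of $n$ non-communicating quantum provers consists of complex Hilbert spaces $\mathcal H_v$ ($v\in V$) of arbitrary dimension, a unit vector $|\psi'\rangle\in\bigotimes_v\mathcal H_v$, and for each $v$ four $\pm1$-valued observables (self-adjoint operators with square $I$) $X'_v,\ Z'_v,\ R'_v(\theta_v),\ R'_v(-\theta_v)$ on $\mathcal H_v$. These answer the four queries to prover $v$, and the four observables are arbitrary, whether or not $\theta_v=0$. A queried prover measures the corresponding observable on its share and replies with the outcome;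 a prover that is not queried counts as replying $1$. The honest provers hold one qubit each, share the graph state $|G\rangle=2^{-n/2}\sum_{x\in\{0,1\}^n}(-1)^{\frac12x\cdot\mathbf Ax}|x\rangle$, and measure $X_v$, $Z_v$ and $R_v(\pm\theta_v)=\cos\theta_v\,X_v\pm\sin\theta_v\,Z_v$, where $X$ and $Z$ are the Pauli matrices. \textbf{One-shot test.} Choose one of the following, with probability $|V|/N_G$, $|T|/N_G$, $2|V|/N_G$ respectively. \begin{itemize} \item VERTEX: choose $v\in V$ uniformly, query $X_vZ^{\mathbf A1_v}$, and accept iff the product of the replies is $1$. \item TRIANGLE: choose $\tau\in T$ uniformly, query $X^\tau Z^{\mathbf A\tau}$, and accept iff the product of the replies is $-1$. \item RTHETA: choose $t\in\{1,-1\}$ and $v\in V$ uniformly and put $u=u(v)$. With probability $\frac{\cos\theta_v}{\cos\theta_v+|\sin\theta_v|}$ query $R_v(t\theta_v)Z^{\mathbf A1_v}$ and accept iff the product of the replies is $1$; otherwise (with probability $\frac{|\sin\theta_v|}{\cos\theta_v+|\sin\theta_v|}$) query $R_v(t\theta_v)X_uZ^{\mathbf A1_u\oplus1_v}$ and accept iff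 $t$ times the product of the replies is $1$. \end{itemize} \textbf{Lemma.} Let $$c_{test}=\frac{1}{N_G}\Bigl(2|V|+|T|+\sum_{v}\frac1{\cos\theta_v+|\sin\theta_v|}\Bigr).$$ \begin{enumerate} \item The honest provers are accepted with probability exactly $c_{test}$. \item Every set of quantum provers is accepted with probability at most $c_{test}$. \item For all $|\psi'\rangle$, $X'_v$, $Z'_v$ there are a local isometry $\Phi=\bigotimes_v\Phi_v$, where $\Phi_v$ maps $\mathcal H_v$ into $(\mathcal H_v\otimes\mathbb C^2)\otimes\mathbb C^2$, and a unit vector $|junk\rangle\in\bigotimes_v(\mathcal H_v\otimes\mathbb C^2)$, which depend neither on the test parameters $T,u,\theta$ nor on the observables $R'_v$, such that the following holds for all $T,u,\theta$, all observables $R'_v(\pm\theta_v)$ and all $\delta\ge0$: if for some $v\in V$ and some $M\in\{X_v,Z_v,R_v(\theta_v),R_v(-\theta_v)\}$, with $M'$ the corresponding observable of prover $v$, $$\bigl\|\Phi(M'|\psi'\rangle)-|junk\rangle\, M|G\rangle\bigr\|>\delta,$$ then the provers are accepted with probability at most $$c_{test}-\frac1{2N_G}\Bigl(\frac{\delta^2}{22+25\sqrt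 n}\Bigr)^4.$$ \end{enumerate} -/

import Mathlib

open scoped InnerProductSpace BigOperators

noncomputable section

/-! ### Hilbert space tensor products of finitely many parties -/

/-- `K` is the Hilbert space tensor product of the spaces `H v`, with `tmul x = ⨂ᵥ x v`. -/
structure HilbertTensor {V : Type*} [Fintype V] (H : V → Type*)
    [∀ v, NormedAddCommGroup (H v)] [∀ v, InnerProductSpace ℂ (H v)]
    (K : Type*) [NormedAddCommGroup K] [InnerProductSpace ℂ K] where
  tmul : MultilinearMap ℂ H K
  inner_tmul : ∀ x y : ∀ v, H v, ⟪tmul x, tmul y⟫_ℂ = ∏ v, ⟪x v, y v⟫_ℂ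
  dense_span : (Submodule.span ℂ (Set.range tmul)).topologicalClosure = ⊤

namespace HilbertTensor

section Map

variable {V : Type*} [Fintype V] {H H' : V → Type*}
  [∀ v, NormedAddCommGroup (H v)] [∀ v, InnerProductSpace ℂ (H v)]
  [∀ v, NormedAddCommGroup (H' v)] [∀ v, InnerProductSpace ℂ (H' v)]
  {K K' : Type*} [NormedAddCommGroup K] [InnerProductSpace ℂ K]
  [NormedAddCommGroup K'] [InnerProductSpace ℂ K']

/-- The canonical map from the algebraic tensor product. -/
def lift (T : HilbertTensor H K) : PiTensorProduct ℂ H →ₗ[ℂ] K :=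
  PiTensorProduct.lift T.tmul

theorem lift_tprod (T : HilbertTensor H K) (x : ∀ v, H v) :
    T.lift (PiTensorProduct.tprod ℂ x) = T.tmul x := by
  simp [lift]

theorem denseRange_lift (T : HilbertTensor H K) : DenseRange T.lift := by
  have h1 : Submodule.span ℂ (Set.range T.tmul) ≤ LinearMap.range T.lift := by
    rw [Submodule.span_le]
    rintro _ ⟨x, rfl⟩
    exact ⟨_, T.lift_tprod x⟩
  intro y
  have hy : y ∈ (Submodule.span ℂ (Set.range T.tmul)).topologicalClosure := by
    rw [T.dense_span]; trivial
  exact closure_mono (fun z hz => h1 hz) hy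

/-- The product `⨂ᵥ φ v` of local isometries on the algebraic tensor product. -/
def algMap (T' : HilbertTensor H' K') (φ : ∀ v, H v →ₗᵢ[ℂ] H' v) :
    PiTensorProduct ℂ H →ₗ[ℂ] K' :=
  PiTensorProduct.lift (T'.tmul.compLinearMap fun v => (φ v).toLinearMap)

theorem inner_algMap (T : HilbertTensor H K) (T' : HilbertTensor H' K')
    (φ : ∀ v, H v →ₗᵢ[ℂ] H' v) (a b : PiTensorProduct ℂ H) :
    ⟪T'.algMap φ a, T'.algMap φ b⟫_ℂ = ⟪T.lift a, T.lift b⟫_ℂ := by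
  induction a using PiTensorProduct.induction_on with
  | smul_tprod r x =>
    induction b using PiTensorProduct.induction_on with
    | smul_tprod s y =>
      simp [algMap, lift, inner_tmul]
    | add b b' hb hb' => simp only [map_add, inner_add_right, hb, hb']
  | add a a' ha ha' => simp only [map_add, inner_add_left, ha, ha']

theorem norm_algMap (T : HilbertTensor H K) (T' : HilbertTensor H' K')
    (φ : ∀ v, H v →ₗᵢ[ℂ] H' v) (a : PiTensorProduct ℂ H) :
    ‖T'.algMap φ a‖ = ‖T.lift a‖ := by
  rw [@norm_eq_sqrt_re_inner ℂ, @norm_eq_sqrt_re_inner ℂ _ _ _ _ (T.lift a),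
    T.inner_algMap T' φ a a]

/-- Two continuous linear maps that agree on product vectors are equal. -/
theorem ext_clm (T : HilbertTensor H K) {A B : K →L[ℂ] K'}
    (h : ∀ x, A (T.tmul x) = B (T.tmul x)) : A = B := by
  have h1 : A.toLinearMap.comp T.lift = B.toLinearMap.comp T.lift := by
    apply PiTensorProduct.ext
    ext x
    simpa [lift] using h x
  refine ContinuousLinearMap.coeFn_injective
    (T.denseRange_lift.equalizer A.continuous B.continuous ?_)
  funext a
  exact LinearMap.congr_fun h1 a

variable [CompleteSpace K']

/-- The tensor product `⨂ᵥ φ v` of local isometries, see `map_tmul`. -/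
def map (T : HilbertTensor H K) (T' : HilbertTensor H' K') (φ : ∀ v, H v →ₗᵢ[ℂ] H' v) :
    K →ₗᵢ[ℂ] K' where
  toLinearMap := ((T'.algMap φ).extendOfNorm T.lift).toLinearMap
  norm_map' := by
    have hb : ∃ C, ∀ a, ‖T'.algMap φ a‖ ≤ C * ‖T.lift a‖ :=
      ⟨1, fun a => by rw [one_mul, T.norm_algMap T' φ a]⟩
    intro y
    refine T.denseRange_lift.induction_on
      (p := fun y => ‖((T'.algMap φ).extendOfNorm T.lift) y‖ = ‖y‖) y
      (isClosed_eq (by fun_prop) (by fun_prop)) fun a => ?_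
    rw [LinearMap.extendOfNorm_eq T.denseRange_lift hb, T.norm_algMap T' φ a]

theorem map_tmul (T : HilbertTensor H K) (T' : HilbertTensor H' K')
    (φ : ∀ v, H v →ₗᵢ[ℂ] H' v) (x : ∀ v, H v) :
    T.map T' φ (T.tmul x) = T'.tmul fun v => φ v (x v) := by
  have hb : ∃ C, ∀ a, ‖T'.algMap φ a‖ ≤ C * ‖T.lift a‖ :=
    ⟨1, fun a => by rw [one_mul, T.norm_algMap T' φ a]⟩
  have h := LinearMap.extendOfNorm_eq T.denseRange_lift hb (PiTensorProduct.tprod ℂ x)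
  rw [T.lift_tprod] at h
  refine h.trans ?_
  simp [algMap]

end Map

section Existence

universe u w

variable {V : Type u} (H : V → Type w)
  [∀ v, NormedAddCommGroup (H v)] [∀ v, InnerProductSpace ℂ (H v)]

/-- The Gram kernel `(x, y) ↦ ∏ᵥ ⟪x v, y v⟫` of product vectors. -/
def gramKernel (s : Finset V) : Matrix (∀ v, H v) (∀ v, H v) ℂ :=
  Matrix.of fun x y => ∏ v ∈ s, ⟪x v, y v⟫_ℂ

open scoped ComplexOrder in
theorem posSemidef_gram' {n E : Type*} [NormedAddCommGroup E] [InnerProductSpace ℂ E]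
    (f : n → E) : (Matrix.gram ℂ f).PosSemidef := by
  refine ⟨Matrix.isHermitian_gram ℂ f, fun x => ?_⟩
  have h : (x.sum fun i xi => x.sum fun j xj => star xi * Matrix.gram ℂ f i j * xj)
      = ⟪x.sum fun i xi => xi • f i, x.sum fun i xi => xi • f i⟫_ℂ := by
    simp only [Finsupp.sum, sum_inner, inner_sum, inner_smul_left, inner_smul_right,
      Matrix.gram_apply]
    rw [Finset.sum_comm]
    refine Finset.sum_congr rfl fun i _ => ?_
    rw [Finset.mul_sum]
    refine Finset.sum_congr rfl fun j _ => ?_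
    simp only [RCLike.star_def]
    ring
  rw [h, inner_self_eq_norm_sq_to_K]
  positivity

open scoped ComplexOrder Matrix in
theorem posSemidef_gramKernel (s : Finset V) : (gramKernel H s).PosSemidef := by
  classical
  induction s using Finset.induction_on with
  | empty =>
    have h : gramKernel H ∅ = Matrix.gram ℂ (fun _ : (∀ v, H v) => (1 : ℂ)) := by
      ext x y
      simp [gramKernel, Matrix.gram_apply]
    rw [h]
    exact posSemidef_gram' _
  | insert v s hv ih =>
    have h : gramKernel H (insert v s)
        = (Matrix.gram ℂ (fun x : (∀ v, H v) => x v)) ⊙ gramKernel H s := by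
      ext x y
      simp [gramKernel, Matrix.gram_apply, Finset.prod_insert hv]
    rw [h]
    exact (posSemidef_gram' _).hadamard ih

open scoped ComplexOrder in
/-- Every finite family of Hilbert spaces has a Hilbert space tensor product. -/
theorem exists_hilbertTensor [Fintype V] :
    ∃ (K : Type (max u w)) (_ : NormedAddCommGroup K) (_ : InnerProductSpace ℂ K)
      (_ : CompleteSpace K), Nonempty (HilbertTensor H K) := by
  classical
  let k : Matrix (∀ v, H v) (∀ v, H v) (ℂ →L[ℂ] ℂ) :=
    Matrix.of fun x y => gramKernel H Finset.univ x y • ContinuousLinearMap.id ℂ ℂ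
  have hk : Fact k.PosSemidef := by
    have hg := posSemidef_gramKernel H Finset.univ
    have htf := (RKHS.posSemidef_tfae (K := k)).out 0 2
    refine ⟨htf.mpr ⟨?_, fun f => ?_⟩⟩
    · ext x y
      simp only [Matrix.conjTranspose_apply, k, Matrix.of_apply, star_smul, hg.1.apply]
      rw [show star (ContinuousLinearMap.id ℂ ℂ) = ContinuousLinearMap.id ℂ ℂ from
        star_one (ℂ →L[ℂ] ℂ)]
    · have h2 := (Complex.le_def.mp (hg.2 f)).1
      refine h2.trans (le_of_eq (congrArg Complex.re ?_))
      refine Finset.sum_congr rfl fun x _ => Finset.sum_congr rfl fun y _ => ?_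
      have hxy : star (gramKernel H Finset.univ y x) = gramKernel H Finset.univ x y :=
        hg.1.apply x y
      change star (f x) * gramKernel H Finset.univ x y * f y
        = ⟪gramKernel H Finset.univ y x • f x, f y⟫_ℂ
      rw [← hxy]
      simp only [smul_eq_mul, RCLike.inner_apply, RCLike.star_def, map_mul]
      ring
  have hker : ∀ x y, ⟪RKHS.kerFun (RKHS.OfKernel k) x 1, RKHS.kerFun (RKHS.OfKernel k) y 1⟫_ℂ
      = ∏ v, ⟪x v, y v⟫_ℂ := by
    intro x y
    rw [← RKHS.kernel_inner, RKHS.OfKernel.kernel_ofKernel]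
    simp [k, gramKernel]
  have hext : ∀ f g : RKHS.OfKernel k,
      (∀ x, ⟪RKHS.kerFun (RKHS.OfKernel k) x 1, f⟫_ℂ = ⟪RKHS.kerFun (RKHS.OfKernel k) x 1, g⟫_ℂ)
        → f = g := by
    intro f g h
    refine RKHS.ext fun x => ?_
    simpa using h x
  refine ⟨RKHS.OfKernel k, inferInstance, inferInstance, inferInstance, ⟨
    { tmul :=
        { toFun := fun x => RKHS.kerFun (RKHS.OfKernel k) x 1
          map_update_add' := ?_
          map_update_smul' := ?_ }
      inner_tmul := hker
      dense_span := ?_ }⟩⟩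
  · intro _ m i x y
    refine hext _ _ fun z => ?_
    rw [inner_add_right, hker, hker, hker]
    simp only [← Finset.mul_prod_erase Finset.univ _ (Finset.mem_univ i)]
    have key : ∀ w : H i, ∏ v ∈ Finset.univ.erase i, ⟪z v, Function.update m i w v⟫_ℂ
        = ∏ v ∈ Finset.univ.erase i, ⟪z v, m v⟫_ℂ := fun w =>
      Finset.prod_congr rfl fun v hv => by
        rw [Function.update_of_ne (Finset.ne_of_mem_erase hv)]
    simp only [key, Function.update_self, inner_add_right, add_mul]
  · intro _ m i c x
    refine hext _ _ fun z => ?_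
    rw [inner_smul_right, hker, hker]
    simp only [← Finset.mul_prod_erase Finset.univ _ (Finset.mem_univ i)]
    have key : ∀ w : H i, ∏ v ∈ Finset.univ.erase i, ⟪z v, Function.update m i w v⟫_ℂ
        = ∏ v ∈ Finset.univ.erase i, ⟪z v, m v⟫_ℂ := fun w =>
      Finset.prod_congr rfl fun v hv => by
        rw [Function.update_of_ne (Finset.ne_of_mem_erase hv)]
    simp only [key, Function.update_self, inner_smul_right, mul_assoc]
  · refine top_le_iff.mp ?_
    rw [← RKHS.kerFun_dense (RKHS.OfKernel k)]
    refine Submodule.topologicalClosure_mono (Submodule.span_le.mpr ?_)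
    rintro _ ⟨x, c, rfl⟩
    have h := Submodule.smul_mem (Submodule.span ℂ (Set.range
      fun x => RKHS.kerFun (RKHS.OfKernel k) x 1)) c (Submodule.subset_span ⟨x, rfl⟩)
    rw [← map_smul, smul_eq_mul, mul_one] at h
    exact h

end Existence

section Qubits

variable {V : Type*} [Fintype V] [DecidableEq V] {H : V → Type*}
  [∀ v, NormedAddCommGroup (H v)] [∀ v, InnerProductSpace ℂ (H v)]
  {K : Type*} [NormedAddCommGroup K] [InnerProductSpace ℂ K]

/-- The product vectors of `withQubit`. -/
def qubitMul (T : HilbertTensor H K) :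
    MultilinearMap ℂ (fun v => PiLp 2 fun _ : Fin 2 => H v) (PiLp 2 fun _ : V → Fin 2 => K) :=
  { toFun := fun x => WithLp.toLp 2 fun b => T.tmul fun v => x v (b v)
    map_update_add' := by
      intro _ m i x y
      ext b
      have key : ∀ z : PiLp 2 fun _ : Fin 2 => H i,
          (fun v => (Function.update m i z) v (b v))
            = Function.update (fun v => m v (b v)) i (z (b i)) := by
        intro z
        funext v
        by_cases h : v = i
        · subst h; simp
        · simp [h]
      simp [key]
    map_update_smul' := by
      intro _ m i c x
      ext b
      have key : ∀ z : PiLp 2 fun _ : Fin 2 => H i,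
          (fun v => (Function.update m i z) v (b v))
            = Function.update (fun v => m v (b v)) i (z (b i)) := by
        intro z
        funext v
        by_cases h : v = i
        · subst h; simp
        · simp [h]
      simp [key] }

/-- Every party `v` gets one extra qubit: `PiLp 2 (fun _ : Fin 2 => H v)` is `H v ⊗ ℂ²`, and
the qubits of all the parties are jointly described by the index set `V → Fin 2`. -/
def withQubit (T : HilbertTensor H K) :
    HilbertTensor (fun v => PiLp 2 fun _ : Fin 2 => H v) (PiLp 2 fun _ : V → Fin 2 => K) where
  tmul := T.qubitMul
  inner_tmul := by
    classical
    intro x y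
    simp only [qubitMul, MultilinearMap.coe_mk, PiLp.inner_apply, inner_tmul, Finset.prod_univ_sum,
      Fintype.piFinset_univ]
  dense_span := by
    refine Submodule.eq_top_iff'.mpr fun z => ?_
    have hz : z = ∑ b, PiLp.single 2 b (z b) := by
      ext b
      rw [WithLp.ofLp_sum, Finset.sum_apply]
      simp
    rw [hz]
    refine Submodule.sum_mem _ fun b _ => ?_
    let sg : K →ₗ[ℂ] PiLp 2 fun _ : V → Fin 2 => K :=
      (WithLp.linearEquiv 2 ℂ _).symm.toLinearMap.comp (LinearMap.single ℂ (fun _ => K) b)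
    have hc : Continuous sg := (PiLp.continuous_toLp 2 _).comp (continuous_single (A := fun _ => K) b)
    have hk : z b ∈ closure (Submodule.span ℂ (Set.range T.tmul) : Set K) := by
      rw [← Submodule.topologicalClosure_coe, T.dense_span]; trivial
    have hsub : Submodule.span ℂ (Set.range T.tmul) ≤ (Submodule.span ℂ (Set.range T.qubitMul)).comap sg := by
      rw [Submodule.span_le]
      rintro _ ⟨x, rfl⟩
      refine Submodule.subset_span ⟨fun v => PiLp.single 2 (b v) (x v), ?_⟩
      ext c
      by_cases h : c = b
      · subst h
        simp [qubitMul, sg]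
      · obtain ⟨v, hv⟩ := Function.ne_iff.mp h
        have h0 : T.tmul (fun v => (PiLp.single 2 (b v) (x v) : PiLp 2 fun _ : Fin 2 => H v) (c v))
            = 0 := T.tmul.map_coord_zero v (by simp [hv])
        simp [qubitMul, sg, h]
        simpa using h0
    exact map_mem_closure hc hk fun y hy => hsub hy

end Qubits

/-- The tensor product of copies of `ℂ` is `ℂ`. -/
def scalars (V : Type*) [Fintype V] : HilbertTensor (fun _ : V => ℂ) ℂ where
  tmul := MultilinearMap.mkPiAlgebra ℂ V ℂ
  inner_tmul := by
    intro x y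
    simp [Finset.prod_mul_distrib, map_prod]
  dense_span := by
    have h : Submodule.span ℂ (Set.range (MultilinearMap.mkPiAlgebra ℂ V ℂ)) = ⊤ := by
      rw [Submodule.eq_top_iff']
      intro z
      have h1 : (1 : ℂ) ∈ Submodule.span ℂ (Set.range (MultilinearMap.mkPiAlgebra ℂ V ℂ)) :=
        Submodule.subset_span ⟨fun _ => 1, by simp⟩
      simpa using Submodule.smul_mem _ z h1
    rw [h]
    exact top_le_iff.mp (Submodule.le_topologicalClosure _)

/-- The `n`-qubit space, with one qubit for each `v : V`. -/
def qubits (V : Type*) [Fintype V] [DecidableEq V] :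
    HilbertTensor (fun _ : V => EuclideanSpace ℂ (Fin 2)) (EuclideanSpace ℂ (V → Fin 2)) :=
  (scalars V).withQubit

end HilbertTensor

/-! ### Observables and the Born rule -/

/-- A `±1`-valued observable: a self-adjoint operator that squares to the identity. -/
structure Observable (H : Type*) [NormedAddCommGroup H] [InnerProductSpace ℂ H]
    [CompleteSpace H] where
  op : H →L[ℂ] H
  isSelfAdjoint : IsSelfAdjoint op
  sq : op * op = 1

namespace Observable

variable {H : Type*} [NormedAddCommGroup H] [InnerProductSpace ℂ H] [CompleteSpace H]

/-- The identity observable. -/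
def ident (H : Type*) [NormedAddCommGroup H] [InnerProductSpace ℂ H] [CompleteSpace H] :
    Observable H where
  op := 1
  isSelfAdjoint := .one _
  sq := one_mul _

/-- An observable preserves norms. -/
def toIsometry (O : Observable H) : H →ₗᵢ[ℂ] H where
  toLinearMap := O.op.toLinearMap
  norm_map' := by
    intro x
    have h2 : O.op (O.op x) = x := by
      have := congrArg (fun A : H →L[ℂ] H => A x) O.sq
      simpa using this
    have h3 : ⟪O.op x, O.op x⟫_ℂ = ⟪x, x⟫_ℂ := by
      have h4 := ContinuousLinearMap.isSelfAdjoint_iff_isSymmetric.mp O.isSelfAdjoint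
        x (O.op x)
      simp only [ContinuousLinearMap.coe_coe, h2] at h4
      exact h4
    change ‖O.op x‖ = ‖x‖
    rw [@norm_eq_sqrt_re_inner ℂ, @norm_eq_sqrt_re_inner ℂ _ _ _ _ x, h3]

end Observable

namespace HilbertTensor

variable {V : Type*} [Fintype V] [DecidableEq V] {H : V → Type*}
  [∀ v, NormedAddCommGroup (H v)] [∀ v, InnerProductSpace ℂ (H v)] [∀ v, CompleteSpace (H v)]
  {K : Type*} [NormedAddCommGroup K] [InnerProductSpace ℂ K] [CompleteSpace K]

/-- The observable `O` of party `v`, acting on the joint space as `O ⊗ 1`. -/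
def localOp (T : HilbertTensor H K) (v : V) (O : Observable (H v)) : K →L[ℂ] K :=
  (T.map T (Function.update (fun _ => LinearIsometry.id) v O.toIsometry)).toContinuousLinearMap

theorem localOp_tmul (T : HilbertTensor H K) (v : V) (O : Observable (H v)) (x : ∀ v, H v) :
    T.localOp v O (T.tmul x) = T.tmul (Function.update x v (O.op (x v))) := by
  change T.map T _ (T.tmul x) = _
  rw [map_tmul]
  congr 1
  funext w
  by_cases h : w = v
  · subst h
    simp [Observable.toIsometry]
  · simp [h]

theorem commute_localOp (T : HilbertTensor H K) {v w : V} (hvw : v ≠ w) (O : Observable (H v))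
    (P : Observable (H w)) : Commute (T.localOp v O) (T.localOp w P) := by
  refine T.ext_clm fun x => ?_
  simp only [mul_apply_eq_comp, localOp_tmul]
  rw [Function.update_of_ne hvw, Function.update_of_ne hvw.symm, Function.update_comm hvw.symm]

/-- The projection onto reply `a` of party `v` when it measures `O`. -/
def replyProj (T : HilbertTensor H K) (v : V) (O : Observable (H v)) (a : ℤˣ) : K →L[ℂ] K :=
  (1 / 2 : ℂ) • (1 + ((a : ℤ) : ℂ) • T.localOp v O)

theorem commute_replyProj (T : HilbertTensor H K) {v w : V} (hvw : v ≠ w) (O : Observable (H v))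
    (P : Observable (H w)) (a b : ℤˣ) : Commute (T.replyProj v O a) (T.replyProj w P b) :=
  (((Commute.one_right _).add_right ((((Commute.one_left _).add_left
    ((T.commute_localOp hvw O P).smul_left _))).smul_right _)).smul_left _).smul_right _

/-- The joint projection onto the replies `a`, when every party `v` measures `O v`. -/
def outcomeProj (T : HilbertTensor H K) (O : ∀ v, Observable (H v)) (a : V → ℤˣ) : K →L[ℂ] K :=
  Finset.univ.noncommProd (fun v => T.replyProj v (O v) (a v))
    fun _ _ _ _ hvw => T.commute_replyProj hvw _ _ _ _

/-- Born rule: the probability that the product of all the replies is `σ`, when every party `v`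
measures `O v` on the joint state `ψ`. -/
def productProb (T : HilbertTensor H K) (ψ : K) (O : ∀ v, Observable (H v)) (σ : ℤˣ) : ℝ :=
  ∑ a : V → ℤˣ, if ∏ v, a v = σ then ‖T.outcomeProj O a ψ‖ ^ 2 else 0

end HilbertTensor

/-! ### The one-shot test -/

/-- The four bases that a prover `v` can be asked for; `R t` stands for `R_v(t θ_v)`. -/
inductive MeasBasis
  | X
  | Z
  | R (t : ℤˣ)

/-- A query assigns a basis to each prover; `none` means that the prover is ignored. -/
abbrev Query (V : Type*) := V → Option MeasBasis

section Queries

variable {V : Type*} [Fintype V] [DecidableEq V] (G : SimpleGraph V) [DecidableRel G.Adj]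

/-- The query `X_v Z^{A 1_v}`. -/
def vertexQuery (v : V) : Query V := fun w =>
  if w = v then some .X else if G.Adj v w then some .Z else none

/-- The query `X^τ Z^{A τ}`, with `A τ` over the integers modulo `2`. -/
def triangleQuery (τ : Finset V) : Query V := fun w =>
  if w ∈ τ then some .X else if Odd (τ.filter fun z => G.Adj z w).card then some .Z else none

/-- The query `R_v(t θ_v) Z^{A 1_v}`. -/
def rxQuery (v : V) (t : ℤˣ) : Query V := fun w =>
  if w = v then some (.R t) else if G.Adj v w then some .Z else none

/-- The query `R_v(t θ_v) X_u Z^{A 1_u ⊕ 1_v}`, for an edge `u v`. -/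
def rzQuery (v u : V) (t : ℤˣ) : Query V := fun w =>
  if w = v then some (.R t) else if w = u then some .X else if G.Adj u w then some .Z else none

end Queries

/-- The parameters of the one-shot test for the graph `G`: a set of triangles covering the
vertices, a neighbour of each vertex, and an angle for each vertex. -/
structure OneShotTest {V : Type*} [Fintype V] [DecidableEq V] (G : SimpleGraph V) where
  triangles : Finset (Finset V)
  isTriangle : ∀ τ ∈ triangles, G.IsNClique 3 τ
  cover : ∀ v, ∃ τ ∈ triangles, v ∈ τ
  nbr : V → V
  adj_nbr : ∀ v, G.Adj v (nbr v)
  θ : V → ℝ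
  θ_nonneg : ∀ v, 0 ≤ θ v
  θ_le : ∀ v, θ v ≤ Real.pi / 2

namespace OneShotTest

variable {V : Type*} [Fintype V] [DecidableEq V] {G : SimpleGraph V} (𝒯 : OneShotTest G)

/-- `N_G = 3 |V| + |T|`. -/
def N : ℝ := 3 * Fintype.card V + 𝒯.triangles.card

/-- `cos θ_v + |sin θ_v|`. -/
def normalizer (v : V) : ℝ := Real.cos (𝒯.θ v) + |Real.sin (𝒯.θ v)|

/-- The optimal acceptance probability. -/
def cTest : ℝ :=
  (2 * Fintype.card V + 𝒯.triangles.card + ∑ v, 1 / 𝒯.normalizer v) / 𝒯.N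

variable [DecidableRel G.Adj]

/-- The acceptance probability of the procedure, given for each query `q` and sign `σ` the
probability `p q σ` that the product of the replies to `q` is `σ`. -/
def acceptWith (p : Query V → ℤˣ → ℝ) : ℝ :=
  Fintype.card V / 𝒯.N * (𝔼 v, p (vertexQuery G v) 1)
  + 𝒯.triangles.card / 𝒯.N * (𝔼 τ ∈ 𝒯.triangles, p (triangleQuery G τ) (-1))
  + 2 * Fintype.card V / 𝒯.N * (𝔼 t : ℤˣ, 𝔼 v,
      (Real.cos (𝒯.θ v) / 𝒯.normalizer v * p (rxQuery G v t) 1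
      + |Real.sin (𝒯.θ v)| / 𝒯.normalizer v * p (rzQuery G v (𝒯.nbr v) t) t))

variable {H : V → Type*} [∀ v, NormedAddCommGroup (H v)] [∀ v, InnerProductSpace ℂ (H v)]
  [∀ v, CompleteSpace (H v)]
  {K : Type*} [NormedAddCommGroup K] [InnerProductSpace ℂ K] [CompleteSpace K]

/-- The probability that provers with joint state `ψ` and observables `obs` are accepted. -/
def acceptProb (T : HilbertTensor H K) (ψ : K) (obs : ∀ v, MeasBasis → Observable (H v)) : ℝ :=
  𝒯.acceptWith fun q σ => T.productProb ψ
    (fun v => match q v with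
      | none => .ident (H v)
      | some b => obs v b) σ

end OneShotTest

/-- The observables used by a prover, from its observables for the four bases. -/
def answer {H : Type*} [NormedAddCommGroup H] [InnerProductSpace ℂ H] [CompleteSpace H]
    (X Z : Observable H) (R : ℤˣ → Observable H) : MeasBasis → Observable H
  | .X => X
  | .Z => Z
  | .R t => R t

/-! ### The ideal provers -/

/-- The observable given by a Hermitian `2 × 2` matrix that squares to the identity. -/
def qubitObservable (M : Matrix (Fin 2) (Fin 2) ℂ) (h : M.IsHermitian) (h2 : M * M = 1) :
    Observable (EuclideanSpace ℂ (Fin 2)) where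
  op := Matrix.toEuclideanCLM (n := Fin 2) (𝕜 := ℂ) M
  isSelfAdjoint := by
    rw [IsSelfAdjoint, ← map_star]
    exact congrArg _ h
  sq := by rw [← map_mul, h2, map_one]

/-- The matrix `R(θ) = cos θ X + sin θ Z`. -/
def rotMatrix (θ : ℝ) : Matrix (Fin 2) (Fin 2) ℂ :=
  (Real.cos θ : ℂ) • !![0, 1; 1, 0] + (Real.sin θ : ℂ) • !![1, 0; 0, -1]

/-- The Pauli observable `X`. -/
def pauliX : Observable (EuclideanSpace ℂ (Fin 2)) :=
  qubitObservable !![0, 1; 1, 0]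
    (by ext i j; fin_cases i <;> fin_cases j <;> simp)
    (by ext i j; fin_cases i <;> fin_cases j <;> simp)

/-- The Pauli observable `Z`. -/
def pauliZ : Observable (EuclideanSpace ℂ (Fin 2)) :=
  qubitObservable !![1, 0; 0, -1]
    (by ext i j; fin_cases i <;> fin_cases j <;> simp)
    (by ext i j; fin_cases i <;> fin_cases j <;> simp)

/-- The observable `R(θ)`. -/
def rot (θ : ℝ) : Observable (EuclideanSpace ℂ (Fin 2)) :=
  qubitObservable (rotMatrix θ)
    (by
      ext i j
      fin_cases i <;> fin_cases j <;>
        simp [rotMatrix, -Complex.ofReal_cos, -Complex.ofReal_sin])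
    (by
      have h : (Real.cos θ : ℂ) * Real.cos θ + Real.sin θ * Real.sin θ = 1 := by
        have := Real.cos_sq_add_sin_sq θ
        rw [pow_two, pow_two] at this
        exact_mod_cast this
      ext i j
      fin_cases i <;> fin_cases j <;>
        simp [rotMatrix, Matrix.mul_apply, Fin.sum_univ_two,
          -Complex.ofReal_cos, -Complex.ofReal_sin] <;>
        first | linear_combination h | ring)

/-- The observables of an honest prover with angle `θ`. -/
def ideal (θ : ℝ) : MeasBasis → Observable (EuclideanSpace ℂ (Fin 2)) :=
  answer pauliX pauliZ fun t => rot (((t : ℤ) : ℝ) * θ)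

/-- The graph state `2^{-n/2} ∑ₓ (-1)^{e(x)} |x⟩`, where `e(x)` is the number of edges of `G`
with both ends in `{v | x v = 1}`. -/
def graphState {V : Type*} [Fintype V] [DecidableEq V] (G : SimpleGraph V) [DecidableRel G.Adj] :
    EuclideanSpace ℂ (V → Fin 2) :=
  WithLp.toLp 2 fun x =>
    ((Real.sqrt (2 ^ Fintype.card V) : ℝ) : ℂ)⁻¹
      * (-1) ^ (G.edgeFinset.filter fun e => ∀ v ∈ e, x v = 1).card

/-- The vector `|junk⟩ ⊗ φ`, for `φ` a state of the qubits `V`. -/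
def junkTensor {V : Type*} {E : Type*} [NormedAddCommGroup E] [InnerProductSpace ℂ E]
    (junk : E) (φ : EuclideanSpace ℂ (V → Fin 2)) : PiLp 2 fun _ : V → Fin 2 => E :=
  WithLp.toLp 2 fun b => φ b • junk

end

/-!
A query is answered by commuting `±1`-valued observables, so its product of replies has expectation
`Re ⟪ψ, O ψ⟫`, where `O` is the product of the observables (`HilbertTensor.productProb_eq`). Hence
the acceptance probability is `cTest` minus a multiple of a weighted sum of squares, the
*deviation* (`OneShotTest.acceptProb_eq`): the squared norms of `S_v ψ - ψ` for the stabilizers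
`S_v = X_v Z^{N(v)}`, of `S_τ ψ + ψ` for the triangles, and of `R_v(±θ) ψ - w_±` with
`w_± = (cos θ Z^{N(v)} ± sin θ X_u Z^{N(u) ∖ v}) ψ`. The last part uses `‖w_+‖² + ‖w_-‖² = 2`. So no
provers exceed `cTest`, and the honest ones, for whom all these vectors vanish, attain it.

For the self-test, `Φ_v` is the swap isometry `x ↦ (1 + Z)/2 x ⊗ |0⟩ + X (1 - Z)/2 x ⊗ |1⟩`. It
intertwines `Z` with the Pauli operator exactly, and `X` up to the anticommutator of `X` and `Z`
(`HilbertTensor.norm_swap_localOp_X_sub`). On a triangle the operator `S_τ S_a S_v S_c` is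
`X_v Z_v X_v Z_v`, so the anticommutator is small on `ψ` when the deviation `D` is small. Therefore
`Φ ψ` is fixed up to `O(√D)` by each ideal stabilizer of the graph state. Controlled `Z` gates turn
the stabilizers into the operators `X_v`, and averaging over the group that these generate shows
that `Φ ψ` is within `O(n √D)` of some `junk ⊗ |G⟩` (`exists_unit_norm_sub_junkTensor_le`); here
`junk` is built from `Φ ψ` alone. The relation `R_v(±θ) ψ ≈ w_± ≈ (cos θ X_v ± sin θ Z_v) ψ` carries
this over to the `R` observables. All these distances are at most `2`, and the eighth power in the
claimed bound leaves room for the factor `n` (`pow_four_le_of_lt`).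
-/

/-! ### Product observables and the Born rule -/

namespace HilbertTensor

section Joint

variable {V : Type*} [Fintype V] {H H' H'' : V → Type*}
  [∀ v, NormedAddCommGroup (H v)] [∀ v, InnerProductSpace ℂ (H v)]
  [∀ v, NormedAddCommGroup (H' v)] [∀ v, InnerProductSpace ℂ (H' v)]
  [∀ v, NormedAddCommGroup (H'' v)] [∀ v, InnerProductSpace ℂ (H'' v)]
  {K K' K'' : Type*} [NormedAddCommGroup K] [InnerProductSpace ℂ K]
  [NormedAddCommGroup K'] [InnerProductSpace ℂ K'] [CompleteSpace K']
  [NormedAddCommGroup K''] [InnerProductSpace ℂ K''] [CompleteSpace K'']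

theorem map_map (T : HilbertTensor H K) (T' : HilbertTensor H' K') (T'' : HilbertTensor H'' K'')
    (φ : ∀ v, H v →ₗᵢ[ℂ] H' v) (φ' : ∀ v, H' v →ₗᵢ[ℂ] H'' v) (y : K) :
    T'.map T'' φ' (T.map T' φ y) = T.map T'' (fun v => (φ' v).comp (φ v)) y := by
  refine DFunLike.congr_fun (T.ext_clm
    (A := ((T'.map T'' φ').comp (T.map T' φ)).toContinuousLinearMap)
    (B := (T.map T'' fun v => (φ' v).comp (φ v)).toContinuousLinearMap) fun x => ?_) y
  simp [map_tmul]

theorem map_id [CompleteSpace K] (T : HilbertTensor H K) (y : K) :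
    T.map T (fun _ => LinearIsometry.id) y = y := by
  refine DFunLike.congr_fun (T.ext_clm
    (A := (T.map T fun _ => LinearIsometry.id).toContinuousLinearMap)
    (B := ContinuousLinearMap.id ℂ K) fun x => ?_) y
  simp [map_tmul]

theorem map_congr (T : HilbertTensor H K) (T' : HilbertTensor H' K')
    {φ φ' : ∀ v, H v →ₗᵢ[ℂ] H' v} (h : ∀ v x, φ v x = φ' v x) (y : K) :
    T.map T' φ y = T.map T' φ' y := by
  rw [show φ = φ' from funext fun v => LinearIsometry.ext (h v)]

/-- Operators are determined by their matrix elements between product vectors. -/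
theorem ext_inner_tmul (T : HilbertTensor H K) {A B : K →L[ℂ] K}
    (h : ∀ x y, ⟪T.tmul y, A (T.tmul x)⟫_ℂ = ⟪T.tmul y, B (T.tmul x)⟫_ℂ) : A = B := by
  refine T.ext_clm fun x => ext_inner_right ℂ fun z => ?_
  refine DFunLike.congr_fun (T.ext_clm (A := innerSL ℂ (A (T.tmul x)))
    (B := innerSL ℂ (B (T.tmul x))) fun y => ?_) z
  simp only [innerSL_apply_apply]
  rw [← inner_conj_symm, h, inner_conj_symm]

end Joint

variable {V : Type*} [Fintype V] {H : V → Type*}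
  [∀ v, NormedAddCommGroup (H v)] [∀ v, InnerProductSpace ℂ (H v)] [∀ v, CompleteSpace (H v)]
  {K : Type*} [NormedAddCommGroup K] [InnerProductSpace ℂ K] [CompleteSpace K]

/-- The observable `⨂ᵥ O v`, whose value is the product of all the replies. -/
noncomputable def jointOp (T : HilbertTensor H K) (O : ∀ v, Observable (H v)) : K →ₗᵢ[ℂ] K :=
  T.map T fun v => (O v).toIsometry

theorem jointOp_tmul (T : HilbertTensor H K) (O : ∀ v, Observable (H v)) (x : ∀ v, H v) :
    T.jointOp O (T.tmul x) = T.tmul fun v => (O v).op (x v) :=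
  T.map_tmul T _ x

variable [DecidableEq V]

theorem replyProj_tmul (T : HilbertTensor H K) (v : V) (O : Observable (H v)) (a : ℤˣ)
    (x : ∀ v, H v) :
    T.replyProj v O a (T.tmul x)
      = T.tmul (Function.update x v ((1 / 2 : ℂ) • (x v + ((a : ℤ) : ℂ) • O.op (x v)))) := by
  rw [MultilinearMap.map_update_smul, MultilinearMap.map_update_add,
    MultilinearMap.map_update_smul, Function.update_eq_self]
  simp [replyProj, localOp_tmul]

theorem outcomeProj_tmul (T : HilbertTensor H K) (O : ∀ v, Observable (H v)) (a : V → ℤˣ)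
    (x : ∀ v, H v) :
    T.outcomeProj O a (T.tmul x)
      = T.tmul fun v => (1 / 2 : ℂ) • (x v + ((a v : ℤ) : ℂ) • (O v).op (x v)) := by
  have key : ∀ (s : Finset V) (hs : (s : Set V).Pairwise
      (Function.onFun Commute fun v => T.replyProj v (O v) (a v))),
      s.noncommProd (fun v => T.replyProj v (O v) (a v)) hs (T.tmul x)
        = T.tmul fun v => if v ∈ s then
            (1 / 2 : ℂ) • (x v + ((a v : ℤ) : ℂ) • (O v).op (x v)) else x v := by
    intro s
    induction s using Finset.induction_on with
    | empty => intro hs; simp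
    | insert v s hv ih =>
      intro hs
      rw [Finset.noncommProd_insert_of_notMem _ _ _ _ hv]
      refine (congrArg (T.replyProj v (O v) (a v)) (ih _)).trans ?_
      rw [replyProj_tmul]
      congr 1
      funext w
      by_cases h : w = v
      · subst h; simp [hv]
      · simp [h]
  refine (key Finset.univ fun _ _ _ _ hvw => T.commute_replyProj hvw _ _ _ _).trans ?_
  simp

theorem _root_.Observable.op_op {H : Type*} [NormedAddCommGroup H] [InnerProductSpace ℂ H]
    [CompleteSpace H] (O : Observable H) (x : H) : O.op (O.op x) = x := by
  simpa using congrArg (fun A : H →L[ℂ] H => A x) O.sq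

theorem _root_.Observable.inner_op_left {H : Type*} [NormedAddCommGroup H]
    [InnerProductSpace ℂ H] [CompleteSpace H] (O : Observable H) (x y : H) :
    ⟪O.op x, y⟫_ℂ = ⟪x, O.op y⟫_ℂ :=
  ContinuousLinearMap.isSelfAdjoint_iff_isSymmetric.mp O.isSelfAdjoint x y

/-- The joint outcome operators are orthogonal projections. -/
theorem inner_outcomeProj (T : HilbertTensor H K) (O : ∀ v, Observable (H v)) (a : V → ℤˣ)
    (y z : K) : ⟪T.outcomeProj O a y, T.outcomeProj O a z⟫_ℂ = ⟪y, T.outcomeProj O a z⟫_ℂ := by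
  have h : (ContinuousLinearMap.adjoint (T.outcomeProj O a)) ∘L T.outcomeProj O a
      = T.outcomeProj O a := by
    refine T.ext_inner_tmul fun x y => ?_
    rw [ContinuousLinearMap.comp_apply, ContinuousLinearMap.adjoint_inner_right]
    simp only [outcomeProj_tmul, inner_tmul]
    refine Finset.prod_congr rfl fun v _ => ?_
    have h2 : ⟪(O v).op (y v), (O v).op (x v)⟫_ℂ = ⟪y v, x v⟫_ℂ := by
      rw [Observable.inner_op_left, Observable.op_op]
    simp only [inner_smul_left, inner_smul_right, inner_add_left, inner_add_right, h2,
      Observable.inner_op_left]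
    simp only [map_div₀, map_one, map_ofNat]
    rcases Int.units_eq_one_or (a v) with h | h <;> simp [h] <;> ring
  rw [← ContinuousLinearMap.adjoint_inner_right, ← ContinuousLinearMap.comp_apply, h]

/-- The outcome projections resolve the identity, which is checked on product vectors, where the
sum over the replies factors over the parties. -/
theorem sum_outcomeProj (T : HilbertTensor H K) (O : ∀ v, Observable (H v)) :
    ∑ a, T.outcomeProj O a = 1 := by
  refine T.ext_clm fun x => ?_
  simp only [sum_apply, outcomeProj_tmul]
  rw [← MultilinearMap.map_sum T.tmul
    (fun v (a : ℤˣ) => (1 / 2 : ℂ) • (x v + ((a : ℤ) : ℂ) • (O v).op (x v)))]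
  change _ = T.tmul x
  congr 1
  funext v
  rw [show (Finset.univ : Finset ℤˣ) = {1, -1} from rfl, Finset.sum_pair (by decide)]
  simp only [Units.val_one, Units.val_neg, Int.cast_one, Int.cast_neg]
  module

theorem sum_prod_smul_outcomeProj (T : HilbertTensor H K) (O : ∀ v, Observable (H v)) :
    ∑ a : V → ℤˣ, (∏ v, ((a v : ℤ) : ℂ)) • T.outcomeProj O a
      = (T.jointOp O).toContinuousLinearMap := by
  refine T.ext_clm fun x => ?_
  simp only [sum_apply, smul_apply, outcomeProj_tmul,
    ← MultilinearMap.map_smul_univ]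
  rw [← MultilinearMap.map_sum T.tmul
    (fun v (a : ℤˣ) => ((a : ℤ) : ℂ) • (1 / 2 : ℂ) • (x v + ((a : ℤ) : ℂ) • (O v).op (x v)))]
  change _ = T.jointOp O (T.tmul x)
  rw [jointOp_tmul]
  congr 1
  funext v
  rw [show (Finset.univ : Finset ℤˣ) = {1, -1} from rfl, Finset.sum_pair (by decide)]
  simp only [Units.val_one, Units.val_neg, Int.cast_one, Int.cast_neg]
  module

/-- The probability of a product of replies, through the expectation of the product observable. -/
theorem productProb_eq (T : HilbertTensor H K) {ψ : K} (hψ : ‖ψ‖ = 1)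
    (O : ∀ v, Observable (H v)) (σ : ℤˣ) :
    T.productProb ψ O σ = (1 + ((σ : ℤ) : ℝ) * RCLike.re ⟪ψ, T.jointOp O ψ⟫_ℂ) / 2 := by
  have h1 : ∑ a, RCLike.re ⟪ψ, T.outcomeProj O a ψ⟫_ℂ = 1 := by
    rw [← map_sum, ← inner_sum, ← sum_apply, sum_outcomeProj]
    simp [hψ]
  have h2 : ∑ a : V → ℤˣ, (∏ v, ((a v : ℤ) : ℝ)) * RCLike.re ⟪ψ, T.outcomeProj O a ψ⟫_ℂ
      = RCLike.re ⟪ψ, T.jointOp O ψ⟫_ℂ := by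
    have : T.jointOp O ψ = (T.jointOp O).toContinuousLinearMap ψ := rfl
    rw [this, ← sum_prod_smul_outcomeProj, sum_apply, inner_sum, map_sum]
    refine Finset.sum_congr rfl fun a _ => ?_
    rw [smul_apply, inner_smul_right,
      show (∏ v, ((a v : ℤ) : ℂ)) = ((∏ v, ((a v : ℤ) : ℝ) : ℝ) : ℂ) by push_cast; rfl]
    exact (RCLike.re_ofReal_mul _ _).symm
  have h3 : T.productProb ψ O σ = ∑ a : V → ℤˣ,
      (1 + ((σ : ℤ) : ℝ) * ∏ v, ((a v : ℤ) : ℝ)) / 2 * RCLike.re ⟪ψ, T.outcomeProj O a ψ⟫_ℂ := by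
    refine Finset.sum_congr rfl fun a _ => ?_
    rw [← inner_outcomeProj, ← norm_sq_eq_re_inner,
      show ∏ v, ((a v : ℤ) : ℝ) = (((∏ v, a v : ℤˣ) : ℤ) : ℝ) by simp]
    rcases Int.units_eq_one_or σ with h | h <;>
      rcases Int.units_eq_one_or (∏ v, a v) with h' | h' <;> rw [h, h'] <;>
      simp [show (1 : ℤˣ) ≠ -1 by decide, show (-1 : ℤˣ) ≠ 1 by decide]
  rw [h3, ← h2]
  nth_rewrite 2 [← h1]
  rw [Finset.mul_sum, ← Finset.sum_add_distrib, Finset.sum_div]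
  exact Finset.sum_congr rfl fun a _ => by ring

end HilbertTensor

/-! ### Operators of the queries -/

namespace HilbertTensor

variable {V : Type*} [Fintype V] {H : V → Type*}
  [∀ v, NormedAddCommGroup (H v)] [∀ v, InnerProductSpace ℂ (H v)] [∀ v, CompleteSpace (H v)]
  {K : Type*} [NormedAddCommGroup K] [InnerProductSpace ℂ K] [CompleteSpace K]
  (T : HilbertTensor H K) (obs : ∀ v, MeasBasis → Observable (H v))

theorem _root_.Observable.toIsometry_apply {H : Type*} [NormedAddCommGroup H]
    [InnerProductSpace ℂ H] [CompleteSpace H] (O : Observable H) (x : H) :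
    O.toIsometry x = O.op x := rfl

theorem _root_.Observable.ident_op_apply {H : Type*} [NormedAddCommGroup H]
    [InnerProductSpace ℂ H] [CompleteSpace H] (x : H) :
    (Observable.ident H).op x = x := rfl

/-- The product of the observables that the provers measure on the query `q`. -/
noncomputable def queryOp (q : Query V) : K →ₗᵢ[ℂ] K :=
  T.jointOp fun v => match q v with
    | none => .ident (H v)
    | some b => obs v b

variable [DecidableEq V]

/-- The product `Z^s` of the observables `Z_w` with `w ∈ s`. -/
noncomputable def zOp (s : Finset V) : K →ₗᵢ[ℂ] K :=
  T.queryOp obs fun w => if w ∈ s then some .Z else none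

theorem localOp_apply (v : V) (O : Observable (H v)) (y : K) :
    T.localOp v O y
      = T.map T (Function.update (fun _ => LinearIsometry.id) v O.toIsometry) y := rfl

theorem norm_localOp (v : V) (O : Observable (H v)) (y : K) : ‖T.localOp v O y‖ = ‖y‖ :=
  LinearIsometry.norm_map _ y

theorem localOp_localOp (v : V) (O : Observable (H v)) (y : K) :
    T.localOp v O (T.localOp v O y) = y := by
  rw [localOp_apply, localOp_apply, map_map]
  conv_rhs => rw [← T.map_id y]
  refine T.map_congr T (fun w x => ?_) y
  by_cases h : w = v
  · subst h; simp [Observable.toIsometry_apply, Observable.op_op]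
  · simp [h]

theorem inner_localOp_left (v : V) (O : Observable (H v)) (y z : K) :
    ⟪T.localOp v O y, z⟫_ℂ = ⟪y, T.localOp v O z⟫_ℂ := by
  conv_lhs => rw [← T.localOp_localOp v O z]
  exact LinearIsometry.inner_map_map _ y _

variable (G : SimpleGraph V) [DecidableRel G.Adj]

theorem queryOp_vertexQuery (v : V) (y : K) :
    T.queryOp obs (vertexQuery G v) y
      = T.localOp v (obs v .X) (T.zOp obs (G.neighborFinset v) y) := by
  simp only [zOp, queryOp, jointOp, localOp_apply, map_map]
  refine T.map_congr T (fun w x => ?_) y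
  by_cases h : w = v
  · subst h; simp [vertexQuery, Observable.toIsometry_apply, Observable.ident_op_apply]
  · simp [vertexQuery, h]

theorem queryOp_rxQuery (v : V) (t : ℤˣ) (y : K) :
    T.queryOp obs (rxQuery G v t) y
      = T.localOp v (obs v (.R t)) (T.zOp obs (G.neighborFinset v) y) := by
  simp only [zOp, queryOp, jointOp, localOp_apply, map_map]
  refine T.map_congr T (fun w x => ?_) y
  by_cases h : w = v
  · subst h; simp [rxQuery, Observable.toIsometry_apply, Observable.ident_op_apply]
  · simp [rxQuery, h]

theorem queryOp_rzQuery {v u : V} (huv : u ≠ v) (t : ℤˣ) (y : K) :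
    T.queryOp obs (rzQuery G v u t) y = T.localOp v (obs v (.R t))
      (T.localOp u (obs u .X) (T.zOp obs ((G.neighborFinset u).erase v) y)) := by
  simp only [zOp, queryOp, jointOp, localOp_apply, map_map]
  refine T.map_congr T (fun w x => ?_) y
  by_cases h : w = v
  · subst h
    simp [rzQuery, Observable.toIsometry_apply, Observable.ident_op_apply, huv.symm]
  · by_cases h' : w = u
    · subst h'
      simp [rzQuery, Observable.toIsometry_apply, Observable.ident_op_apply, huv]
    · simp [rzQuery, h, h']

/-- The stabilizer at `u`, with the factor at the neighbour `v` of `u` split off. -/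
theorem queryOp_vertexQuery_of_adj {v u : V} (huv : G.Adj u v) (y : K) :
    T.queryOp obs (vertexQuery G u) y = T.localOp v (obs v .Z)
      (T.localOp u (obs u .X) (T.zOp obs ((G.neighborFinset u).erase v) y)) := by
  simp only [zOp, queryOp, jointOp, localOp_apply, map_map]
  refine T.map_congr T (fun w x => ?_) y
  by_cases h : w = v
  · subst h
    simp [vertexQuery, Observable.toIsometry_apply, Observable.ident_op_apply, huv.ne', huv]
  · by_cases h' : w = u
    · subst h'
      simp [vertexQuery, Observable.toIsometry_apply, Observable.ident_op_apply, huv.ne]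
    · simp [vertexQuery, h, h']

/-- On a triangle, the triangle operator and the three stabilizers `X_v Z^{N(v)}` multiply to
`X Z X Z` at one vertex, and cancel at all the others. This is how the test sees that `X` and `Z`
anticommute. -/
theorem queryOp_triangleQuery {v a c : V} (hva : G.Adj v a) (hvc : G.Adj v c) (hac : G.Adj a c)
    (y : K) :
    T.queryOp obs (triangleQuery G {v, a, c}) (T.queryOp obs (vertexQuery G a)
      (T.queryOp obs (vertexQuery G v) (T.queryOp obs (vertexQuery G c) y)))
      = T.localOp v (obs v .X) (T.localOp v (obs v .Z)
        (T.localOp v (obs v .X) (T.localOp v (obs v .Z) y))) := by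
  simp only [queryOp, jointOp, localOp_apply, map_map]
  refine T.map_congr T (fun w x => ?_) y
  by_cases h : w = v
  · subst h
    simp [vertexQuery, triangleQuery, Observable.toIsometry_apply, hva.symm, hvc.symm, hva.ne,
      hvc.ne]
  by_cases h : w = a
  · subst h
    simp [vertexQuery, triangleQuery, Observable.toIsometry_apply, hva, hac.symm, hva.ne',
      hac.ne, Observable.op_op]
  by_cases h : w = c
  · subst h
    simp [vertexQuery, triangleQuery, Observable.toIsometry_apply, hvc, hac, hvc.ne',
      hac.ne', Observable.op_op]
  by_cases h1 : G.Adj v w <;> by_cases h2 : G.Adj a w <;> by_cases h3 : G.Adj c w <;>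
    simp [vertexQuery, triangleQuery, Observable.toIsometry_apply, *, Finset.filter_insert,
      Finset.filter_singleton, Observable.op_op, Observable.ident_op_apply, hva.ne, hvc.ne,
      hac.ne, show ¬ Odd 2 by decide, show Odd 3 by decide]

end HilbertTensor

/-! ### Pauli operators and the swap isometry -/

section Qubits

variable {V : Type*} {E : Type*} [NormedAddCommGroup E] [InnerProductSpace ℂ E]

/-- The sign `(-1)^{∑_{w ∈ s} b_w}` by which the Pauli operator `Z^s` acts on `|b⟩`. -/
def zSign (s : Finset V) (b : V → Fin 2) : ℂ := ∏ w ∈ s, (-1) ^ (b w : ℕ)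

theorem zSign_mul_self (s : Finset V) (b : V → Fin 2) : zSign s b * zSign s b = 1 := by
  rw [zSign, ← Finset.prod_mul_distrib]
  exact Finset.prod_eq_one fun w _ => by rw [← mul_pow]; simp

theorem norm_zSign (s : Finset V) (b : V → Fin 2) : ‖zSign s b‖ = 1 := by
  simp [zSign, norm_prod]

theorem zSign_add_single [DecidableEq V] {s : Finset V} {v : V} (hv : v ∉ s)
    (b : V → Fin 2) (c : Fin 2) :
    zSign s (b + Pi.single v c) = zSign s b := by
  refine Finset.prod_congr rfl fun w hw => ?_
  have : w ≠ v := fun h => hv (h ▸ hw)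
  simp [this]

variable [Fintype V] [DecidableEq V]

/-- The Pauli operator `Z^s` on the qubits `V`, with coefficients in `E`. -/
noncomputable def zFlip (s : Finset V) :
    (PiLp 2 fun _ : V → Fin 2 => E) →ₗᵢ[ℂ] PiLp 2 fun _ : V → Fin 2 => E where
  toFun f := WithLp.toLp 2 fun b => zSign s b • f b
  map_add' f g := by ext b; simp
  map_smul' c f := by ext b; exact smul_comm _ _ _
  norm_map' f := by simp [PiLp.norm_eq_of_L2, norm_smul, norm_zSign]

theorem zFlip_apply (s : Finset V) (f : PiLp 2 fun _ : V → Fin 2 => E) (b : V → Fin 2) :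
    zFlip s f b = zSign s b • f b := rfl

/-- The Pauli operator `X^a` on the qubits `V`, with coefficients in `E`. -/
noncomputable def xShift (a : V → Fin 2) :
    (PiLp 2 fun _ : V → Fin 2 => E) →ₗᵢ[ℂ] PiLp 2 fun _ : V → Fin 2 => E where
  toFun f := WithLp.toLp 2 fun b => f (b + a)
  map_add' f g := by ext b; simp
  map_smul' c f := by ext b; simp
  norm_map' f := by
    simp only [PiLp.norm_eq_of_L2]
    rw [← Equiv.sum_comp (Equiv.addRight a) fun b => ‖f b‖ ^ 2]
    rfl

theorem xShift_apply (a : V → Fin 2) (f : PiLp 2 fun _ : V → Fin 2 => E) (b : V → Fin 2) :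
    xShift a f b = f (b + a) := rfl

theorem xShift_add (a a' : V → Fin 2) (f : PiLp 2 fun _ : V → Fin 2 => E) :
    xShift (a + a') f = xShift a (xShift a' f) := by
  ext b
  simp [xShift_apply, add_assoc]

/-- The Pauli operator `X_v` on the qubits `V`, with coefficients in `E`. -/
noncomputable abbrev xFlip (v : V) :
    (PiLp 2 fun _ : V → Fin 2 => E) →ₗᵢ[ℂ] PiLp 2 fun _ : V → Fin 2 => E :=
  xShift (Pi.single v 1)

end Qubits

section Swap

variable {H : Type*} [NormedAddCommGroup H] [InnerProductSpace ℂ H] [CompleteSpace H]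

theorem Observable.norm_op (O : Observable H) (x : H) : ‖O.op x‖ = ‖x‖ :=
  O.toIsometry.norm_map x

/-- The local swap isometry `x ↦ (1 + Z)/2 x ⊗ |0⟩ + X (1 - Z)/2 x ⊗ |1⟩`. The inner qubit is not
needed and remains in the state `|0⟩`. -/
noncomputable def swapIsometry (X Z : Observable H) :
    H →ₗᵢ[ℂ] PiLp 2 fun _ : Fin 2 => PiLp 2 fun _ : Fin 2 => H where
  toFun x := WithLp.toLp 2 fun b => PiLp.single 2 0
    ((1 / 2 : ℂ) • if b = 0 then x + Z.op x else X.op (x - Z.op x))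
  map_add' x y := by
    ext b c
    fin_cases b <;> fin_cases c <;> simp <;> module
  map_smul' r x := by
    ext b c
    fin_cases b <;> fin_cases c <;> simp <;> module
  norm_map' x := by
    have h := parallelogram_law_with_norm ℂ x (Z.op x)
    rw [Z.norm_op] at h
    rw [PiLp.norm_eq_of_L2, Fin.sum_univ_two,
      Real.sqrt_eq_iff_eq_sq (by positivity) (by positivity)]
    simp [norm_smul, Observable.norm_op, -map_sub, -smul_add]
    nlinarith

theorem swapIsometry_apply (X Z : Observable H) (x : H) (b : Fin 2) :
    swapIsometry X Z x b = PiLp.single 2 0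
      ((1 / 2 : ℂ) • if b = 0 then x + Z.op x else X.op (x - Z.op x)) := rfl

/-- The isometry `y ↦ 2^{-1/2} (y ⊗ |0⟩ - X y ⊗ |1⟩)`, through which the failure of the swap
isometry to intertwine `X` with the Pauli operator factors. -/
noncomputable def swapDefect (X : Observable H) :
    H →ₗᵢ[ℂ] PiLp 2 fun _ : Fin 2 => PiLp 2 fun _ : Fin 2 => H where
  toFun y := WithLp.toLp 2 fun b => PiLp.single 2 0
    (((Real.sqrt 2 : ℝ) : ℂ)⁻¹ • if b = 0 then y else -X.op y)
  map_add' x y := by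
    ext b c
    fin_cases b <;> fin_cases c <;> simp
    module
  map_smul' r x := by
    ext b c
    fin_cases b <;> fin_cases c
    all_goals simp [smul_comm r]
  norm_map' y := by
    rw [PiLp.norm_eq_of_L2, Fin.sum_univ_two,
      Real.sqrt_eq_iff_eq_sq (by positivity) (by positivity)]
    simp [norm_smul, Observable.norm_op, mul_pow]
    ring

theorem swapDefect_apply (X : Observable H) (y : H) (b : Fin 2) :
    swapDefect X y b = PiLp.single 2 0
      (((Real.sqrt 2 : ℝ) : ℂ)⁻¹ • if b = 0 then y else -X.op y) := rfl

theorem swapIsometry_op_Z (X Z : Observable H) (x : H) (b : Fin 2) :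
    swapIsometry X Z (Z.op x) b = (-1 : ℂ) ^ (b : ℕ) • swapIsometry X Z x b := by
  ext c
  fin_cases b <;> fin_cases c <;> simp [swapIsometry_apply, Z.op_op] <;> module

/-- The defect depends on `x` only through the anticommutator `(X Z + Z X) x`. -/
theorem swapIsometry_op_X (X Z : Observable H) (x : H) (b : Fin 2) :
    swapIsometry X Z (X.op x) b - swapIsometry X Z x (b + 1)
      = ((Real.sqrt 2 : ℝ) : ℂ)⁻¹ •
        (swapDefect X (X.op (Z.op x)) b + swapDefect X (Z.op (X.op x)) b) := by
  have h2 : ((Real.sqrt 2 : ℝ) : ℂ)⁻¹ * ((Real.sqrt 2 : ℝ) : ℂ)⁻¹ = 1 / 2 := by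
    rw [← mul_inv, ← Complex.ofReal_mul, Real.mul_self_sqrt (by norm_num)]
    norm_num
  ext c
  fin_cases b <;> fin_cases c <;>
    simp [swapIsometry_apply, swapDefect_apply, X.op_op, smul_add, smul_smul, h2] <;> module

end Swap

namespace HilbertTensor

variable {V : Type*} [Fintype V] [DecidableEq V] {H : V → Type*}
  [∀ v, NormedAddCommGroup (H v)] [∀ v, InnerProductSpace ℂ (H v)]
  {K : Type*} [NormedAddCommGroup K] [InnerProductSpace ℂ K] (T : HilbertTensor H K)

theorem map_withQubit_tmul {E : Type*} [NormedAddCommGroup E] [InnerProductSpace ℂ E]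
    [CompleteSpace E] {H' : V → Type*}
    [∀ v, NormedAddCommGroup (H' v)] [∀ v, InnerProductSpace ℂ (H' v)]
    (T' : HilbertTensor H' E) (φ : ∀ v, H v →ₗᵢ[ℂ] PiLp 2 fun _ : Fin 2 => H' v)
    (x : ∀ v, H v) (b : V → Fin 2) :
    T.map T'.withQubit φ (T.tmul x) b = T'.tmul fun v => φ v (x v) (b v) := by
  rw [map_tmul]
  rfl

variable [∀ v, CompleteSpace (H v)] [CompleteSpace K]

/-- The global swap isometry `⨂ᵥ Φ_v`. -/
noncomputable def swap (X Z : ∀ v, Observable (H v)) :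
    K →ₗᵢ[ℂ] PiLp 2 fun _ : V → Fin 2 => PiLp 2 fun _ : V → Fin 2 => K :=
  T.map T.withQubit.withQubit fun v => swapIsometry (X v) (Z v)

/-- The swap isometry intertwines products of `Z` observables with products of Pauli operators. -/
theorem swap_zOp (obs : ∀ v, MeasBasis → Observable (H v)) (s : Finset V) (y : K) :
    T.swap (fun v => obs v .X) (fun v => obs v .Z) (T.zOp obs s y)
      = zFlip s (T.swap (fun v => obs v .X) (fun v => obs v .Z) y) := by
  refine DFunLike.congr_fun (T.ext_clm
    (A := ((T.swap (fun v => obs v .X) (fun v => obs v .Z)).comp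
      (T.zOp obs s)).toContinuousLinearMap)
    (B := ((zFlip s).comp
      (T.swap (fun v => obs v .X) (fun v => obs v .Z))).toContinuousLinearMap) fun x => ?_) y
  refine PiLp.ext fun b => ?_
  change T.swap _ _ (T.zOp obs s (T.tmul x)) b = zSign s b • T.swap _ _ (T.tmul x) b
  rw [zOp, queryOp, jointOp_tmul, swap, map_withQubit_tmul, map_withQubit_tmul, zSign,
    show ∏ w ∈ s, (-1 : ℂ) ^ (b w : ℕ) = ∏ w, if w ∈ s then (-1 : ℂ) ^ (b w : ℕ) else 1 by simp,
    ← MultilinearMap.map_smul_univ]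
  congr 1
  funext w
  by_cases h : w ∈ s
  · simp [h, swapIsometry_op_Z]
  · simp [h, Observable.ident_op_apply]

theorem zOp_singleton (obs : ∀ v, MeasBasis → Observable (H v)) (v : V) (y : K) :
    T.zOp obs {v} y = T.localOp v (obs v .Z) y := by
  refine T.map_congr T (fun w x => ?_) y
  by_cases h : w = v
  · subst h; simp
  · simp [h]; rfl

/-- The swap isometry intertwines `X_v` with the Pauli operator up to the anticommutator of `X_v`
and `Z_v`. -/
theorem swap_localOp_X (X Z : ∀ v, Observable (H v)) (v : V) (y : K) :
    T.swap X Z (T.localOp v (X v) y) - xFlip v (T.swap X Z y)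
      = ((Real.sqrt 2 : ℝ) : ℂ)⁻¹ • T.map T.withQubit.withQubit
        (Function.update (fun w => swapIsometry (X w) (Z w)) v (swapDefect (X v)))
        (T.localOp v (X v) (T.localOp v (Z v) y) + T.localOp v (Z v) (T.localOp v (X v) y)) := by
  set Θ := T.map T.withQubit.withQubit
    (Function.update (fun w => swapIsometry (X w) (Z w)) v (swapDefect (X v))) with hΘ
  refine DFunLike.congr_fun (T.ext_clm
    (A := (T.swap X Z).toContinuousLinearMap ∘L T.localOp v (X v)
      - (xFlip v).toContinuousLinearMap ∘L (T.swap X Z).toContinuousLinearMap)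
    (B := ((Real.sqrt 2 : ℝ) : ℂ)⁻¹ • Θ.toContinuousLinearMap ∘L
      (T.localOp v (X v) ∘L T.localOp v (Z v) + T.localOp v (Z v) ∘L T.localOp v (X v)))
    fun x => ?_) y
  refine PiLp.ext fun b => ?_
  change T.swap X Z (T.localOp v (X v) (T.tmul x)) b - T.swap X Z (T.tmul x) (b + Pi.single v 1)
    = ((Real.sqrt 2 : ℝ) : ℂ)⁻¹ • Θ (T.localOp v (X v) (T.localOp v (Z v) (T.tmul x))
      + T.localOp v (Z v) (T.localOp v (X v) (T.tmul x))) b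
  rw [map_add, PiLp.add_apply]
  simp only [localOp_tmul, hΘ, swap, map_withQubit_tmul]
  set m : ∀ w, PiLp 2 fun _ : Fin 2 => H w := fun w => swapIsometry (X w) (Z w) (x w) (b w)
  have e1 : (fun w => swapIsometry (X w) (Z w) (Function.update x v ((X v).op (x v)) w) (b w))
      = Function.update m v (swapIsometry (X v) (Z v) ((X v).op (x v)) (b v)) := by
    funext w
    by_cases h : w = v
    · subst h; simp
    · simp [h, m]
  have e2 : (fun w => swapIsometry (X w) (Z w) (x w) ((b + (Pi.single v 1 : V → Fin 2)) w))
      = Function.update m v (swapIsometry (X v) (Z v) (x v) (b v + 1)) := by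
    funext w
    by_cases h : w = v
    · subst h; simp
    · simp [h, m]
  have e3 : ∀ z : H v, (fun w => Function.update (fun w => swapIsometry (X w) (Z w)) v
      (swapDefect (X v)) w (Function.update x v z w) (b w))
      = Function.update m v (swapDefect (X v) z (b v)) := by
    intro z
    funext w
    by_cases h : w = v
    · subst h; simp
    · simp [h, m]
  simp only [Function.update_idem, Function.update_self, e1, e2, e3]
  rw [← MultilinearMap.map_update_sub, ← MultilinearMap.map_update_add,
    ← MultilinearMap.map_update_smul, swapIsometry_op_X]

theorem norm_swap_localOp_X_sub (X Z : ∀ v, Observable (H v)) (v : V) (y : K) :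
    ‖T.swap X Z (T.localOp v (X v) y) - xFlip v (T.swap X Z y)‖ = (Real.sqrt 2)⁻¹ *
      ‖T.localOp v (X v) (T.localOp v (Z v) y) + T.localOp v (Z v) (T.localOp v (X v) y)‖ := by
  rw [swap_localOp_X, norm_smul, LinearIsometry.norm_map, norm_inv, Complex.norm_real,
    Real.norm_of_nonneg (Real.sqrt_nonneg 2)]

end HilbertTensor

/-! ### Graph states -/

section GraphState

variable {V : Type*} [Fintype V] [DecidableEq V] (G : SimpleGraph V) [DecidableRel G.Adj]
  {E : Type*} [NormedAddCommGroup E] [InnerProductSpace ℂ E]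

/-- The sign of the amplitude of `|b⟩` in the graph state. -/
def edgeSign (b : V → Fin 2) : ℂ :=
  (-1) ^ (G.edgeFinset.filter fun e => ∀ v ∈ e, b v = 1).card

theorem edgeSign_mul_self (b : V → Fin 2) : edgeSign G b * edgeSign G b = 1 := by
  rw [edgeSign, ← mul_pow]; simp

theorem norm_edgeSign (b : V → Fin 2) : ‖edgeSign G b‖ = 1 := by simp [edgeSign]

/-- Flipping `v` changes the status of exactly the edges from `v` to the neighbours `w` with
`b w = 1`. -/
theorem edgeSign_add_single (v : V) (b : V → Fin 2) :
    edgeSign G (b + Pi.single v 1) = edgeSign G b * zSign (G.neighborFinset v) b := by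
  have hprod : ∀ b, edgeSign G b
      = ∏ e ∈ G.edgeFinset, if ∀ v ∈ e, b v = 1 then (-1 : ℂ) else 1 := by
    intro b
    rw [← Finset.prod_filter, Finset.prod_const, edgeSign]
  have key : edgeSign G b * edgeSign G (b + Pi.single v 1) = zSign (G.neighborFinset v) b := by
    rw [hprod, hprod, ← Finset.prod_mul_distrib]
    have hsub : (G.neighborFinset v).image (fun w => s(v, w)) ⊆ G.edgeFinset := by
      intro e he
      obtain ⟨w, hw, rfl⟩ := Finset.mem_image.mp he
      simpa using hw
    rw [← Finset.prod_subset hsub, Finset.prod_image, zSign]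
    · refine Finset.prod_congr rfl fun w hw => ?_
      have hvw : w ≠ v := by
        rintro rfl
        simp at hw
      have h2 : ∀ z : Fin 2, z = 0 ∨ z = 1 := by decide
      rcases h2 (b v) with h | h <;> rcases h2 (b w) with h' | h' <;> simp [h, h', hvw]
    · intro w _ w' _ h
      exact Sym2.congr_right.mp h
    · intro e he hne
      have hv : v ∉ e := by
        rintro hv
        obtain ⟨w, rfl⟩ := hv
        refine hne (Finset.mem_image.mpr ⟨w, ?_, rfl⟩)
        simpa using he
      have h : (∀ w ∈ e, (b + (Pi.single v 1 : V → Fin 2)) w = 1) ↔ ∀ w ∈ e, b w = 1 := by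
        refine forall₂_congr fun w hw => ?_
        have : w ≠ v := fun h => hv (h ▸ hw)
        simp [this]
      simp only [h]
      split_ifs <;> simp
  rw [← key, ← mul_assoc, edgeSign_mul_self, one_mul]

theorem graphState_apply (b : V → Fin 2) :
    graphState G b = ((Real.sqrt (2 ^ Fintype.card V) : ℝ) : ℂ)⁻¹ * edgeSign G b := rfl

theorem inv_sqrt_two_pow_mul_self (n : ℕ) :
    ((Real.sqrt (2 ^ n) : ℝ) : ℂ)⁻¹ * ((Real.sqrt (2 ^ n) : ℝ) : ℂ)⁻¹ = (2 ^ n : ℂ)⁻¹ := by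
  rw [← mul_inv, ← Complex.ofReal_mul, Real.mul_self_sqrt (by positivity)]
  push_cast
  rfl

theorem norm_graphState : ‖graphState G‖ = 1 := by
  rw [PiLp.norm_eq_of_L2]
  simp [graphState_apply, norm_edgeSign, inv_pow]

/-- The stabilizer `X_v Z^{N(v)}` fixes the graph state. -/
theorem xFlip_zFlip_graphState (v : V) :
    xFlip v (zFlip (G.neighborFinset v) (graphState G)) = graphState G := by
  ext b
  simp only [xFlip, xShift_apply, zFlip_apply, graphState_apply, edgeSign_add_single, smul_eq_mul]
  rw [zSign_add_single (by simp)]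
  linear_combination (((Real.sqrt (2 ^ Fintype.card V) : ℝ) : ℂ)⁻¹ * edgeSign G b)
    * zSign_mul_self (G.neighborFinset v) b

/-- The product of the controlled `Z` gates along the edges of `G`, with coefficients in `E`. -/
noncomputable def czFlip :
    (PiLp 2 fun _ : V → Fin 2 => E) →ₗᵢ[ℂ] PiLp 2 fun _ : V → Fin 2 => E where
  toFun f := WithLp.toLp 2 fun b => edgeSign G b • f b
  map_add' f g := by ext b; simp
  map_smul' c f := by ext b; exact smul_comm _ _ _
  norm_map' f := by simp [PiLp.norm_eq_of_L2, norm_smul, norm_edgeSign]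

theorem czFlip_apply (f : PiLp 2 fun _ : V → Fin 2 => E) (b : V → Fin 2) :
    czFlip G f b = edgeSign G b • f b := rfl

/-- The controlled `Z` gates turn the stabilizers of the graph state into the operators `X_v`. -/
theorem xFlip_czFlip (v : V) (f : PiLp 2 fun _ : V → Fin 2 => E) :
    xFlip v (czFlip G f) = czFlip G (zFlip (G.neighborFinset v) (xFlip v f)) := by
  ext b
  simp only [xFlip, xShift_apply, zFlip_apply, czFlip_apply, edgeSign_add_single, smul_smul]

section Junk

omit [Fintype V] [DecidableEq V] in
theorem junkTensor_apply (j : E) (φ : EuclideanSpace ℂ (V → Fin 2)) (b : V → Fin 2) :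
    junkTensor j φ b = φ b • j := rfl

theorem norm_junkTensor (j : E) (φ : EuclideanSpace ℂ (V → Fin 2)) :
    ‖junkTensor j φ‖ = ‖j‖ * ‖φ‖ := by
  have h : ∑ b, ‖φ b • j‖ ^ 2 = ‖j‖ ^ 2 * ∑ b, ‖φ b‖ ^ 2 := by
    rw [Finset.mul_sum]
    exact Finset.sum_congr rfl fun b _ => by rw [norm_smul]; ring
  rw [PiLp.norm_eq_of_L2, PiLp.norm_eq_of_L2]
  simp only [junkTensor_apply]
  rw [h, Real.sqrt_mul (by positivity), Real.sqrt_sq (norm_nonneg j)]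

omit [Fintype V] [DecidableEq V] in
theorem junkTensor_sub_left (j j' : E) (φ : EuclideanSpace ℂ (V → Fin 2)) :
    junkTensor j φ - junkTensor j' φ = junkTensor (j - j') φ := by
  ext b
  simp [junkTensor_apply, smul_sub]

theorem junkTensor_xFlip (v : V) (j : E) (φ : EuclideanSpace ℂ (V → Fin 2)) :
    junkTensor j (xFlip v φ) = xFlip v (junkTensor j φ) := rfl

theorem junkTensor_zFlip (s : Finset V) (j : E) (φ : EuclideanSpace ℂ (V → Fin 2)) :
    junkTensor j (zFlip s φ) = zFlip s (junkTensor j φ) := by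
  ext b
  simp [junkTensor_apply, zFlip_apply, smul_smul]

end Junk

/-- A vector moved by at most `d` by each of the generators `X_v` is moved by at most the sum of
the `d` by every `X^a`. -/
theorem norm_xShift_sub_le (f : PiLp 2 fun _ : V → Fin 2 => E) (a : V → Fin 2) :
    ‖xShift a f - f‖ ≤ ∑ v, ‖xFlip v f - f‖ := by
  have h0 : xShift (0 : V → Fin 2) f = f := by ext b; simp [xShift_apply]
  have key : ∀ s : Finset V,
      ‖xShift (∑ v ∈ s, Pi.single v (a v)) f - f‖ ≤ ∑ v ∈ s, ‖xFlip v f - f‖ := by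
    intro s
    induction s using Finset.induction_on with
    | empty => simp [h0]
    | insert v s hv ih =>
      rw [Finset.sum_insert hv, Finset.sum_insert hv, add_comm (Pi.single v (a v) : V → Fin 2),
        xShift_add]
      have h1 : ‖xShift (Pi.single v (a v)) f - f‖ ≤ ‖xFlip v f - f‖ := by
        rcases (by decide : ∀ z : Fin 2, z = 0 ∨ z = 1) (a v) with h | h
        · simp [h, h0]
        · rw [h]
      calc _ = ‖xShift (∑ v ∈ s, Pi.single v (a v)) (xShift (Pi.single v (a v)) f - f)
            + (xShift (∑ v ∈ s, Pi.single v (a v)) f - f)‖ := by rw [map_sub]; congr 1; abel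
        _ ≤ _ := (norm_add_le _ _).trans
            (add_le_add ((LinearIsometry.norm_map _ _).le.trans h1) ih)
  simpa [Finset.univ_sum_single] using key Finset.univ

/-- A vector that is almost fixed by the stabilizers is close to `j ⊗ |G⟩` for some `j`: the
controlled `Z` gates turn it into a vector almost fixed by all `X^a`, which is close to its average
over `a`. -/
theorem exists_norm_sub_junkTensor_le (Ψ : PiLp 2 fun _ : V → Fin 2 => E) :
    ∃ j : E, ‖Ψ - junkTensor j (graphState G)‖
      ≤ ∑ v, ‖zFlip (G.neighborFinset v) (xFlip v Ψ) - Ψ‖ := by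
  set f := czFlip G Ψ with hf
  set c : ℂ := ((Real.sqrt (2 ^ Fintype.card V) : ℝ) : ℂ)⁻¹ with hc
  have hcc : c * c = (2 ^ Fintype.card V : ℂ)⁻¹ := inv_sqrt_two_pow_mul_self _
  have hD : ∑ v, ‖zFlip (G.neighborFinset v) (xFlip v Ψ) - Ψ‖ = ∑ v, ‖xFlip v f - f‖ :=
    Finset.sum_congr rfl fun v _ => by
      rw [hf, xFlip_czFlip, ← map_sub, LinearIsometry.norm_map]
  refine ⟨c • ∑ b, f b, ?_⟩
  have h1 : czFlip G (Ψ - junkTensor (c • ∑ b, f b) (graphState G))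
      = (2 ^ Fintype.card V : ℂ)⁻¹ • ∑ a : V → Fin 2, (f - xShift a f) := by
    have hsum : ∀ b : V → Fin 2, ∑ a, f (b + a) = ∑ a, f a := fun b =>
      Equiv.sum_comp (Equiv.addLeft b) fun a => f a
    ext b
    simp only [map_sub, PiLp.sub_apply, czFlip_apply, junkTensor_apply, graphState_apply,
      PiLp.smul_apply, Finset.sum_sub_distrib, WithLp.ofLp_sum, Finset.sum_apply, xShift_apply,
      hsum, ← hc, smul_sub, smul_smul]
    rw [show edgeSign G b * (c * edgeSign G b * c) = (2 ^ Fintype.card V : ℂ)⁻¹ by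
      linear_combination (c * c) * edgeSign_mul_self G b + hcc]
    congr 1
    simp [hf, czFlip_apply, ← Nat.cast_smul_eq_nsmul ℂ, smul_smul]
  rw [hD, ← LinearIsometry.norm_map (czFlip G), h1, norm_smul]
  calc _ ≤ ‖(2 ^ Fintype.card V : ℂ)⁻¹‖ * ∑ _a : V → Fin 2, ∑ v, ‖xFlip v f - f‖ := by
        gcongr
        refine (norm_sum_le _ _).trans (Finset.sum_le_sum fun a _ => ?_)
        rw [norm_sub_rev]
        exact norm_xShift_sub_le f a
    _ = _ := by simp

theorem exists_unit_norm_sub_junkTensor_le (Ψ : PiLp 2 fun _ : V → Fin 2 => E) (hΨ : ‖Ψ‖ = 1) :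
    ∃ j : E, ‖j‖ = 1 ∧ ‖Ψ - junkTensor j (graphState G)‖
      ≤ 2 * ∑ v, ‖zFlip (G.neighborFinset v) (xFlip v Ψ) - Ψ‖ := by
  obtain ⟨j, hj⟩ := exists_norm_sub_junkTensor_le G Ψ
  -- If `j = 0` then the right-hand side is at least `2`, and any unit vector will do.
  obtain ⟨i, hi, hij⟩ : ∃ i : E, ‖i‖ = 1 ∧ ‖j - i‖ = |‖j‖ - 1| := by
    by_cases h0 : j = 0
    · have : ∃ b, Ψ b ≠ 0 := by
        by_contra! h
        have : Ψ = 0 := by ext b; exact h b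
        simp [this] at hΨ
      obtain ⟨b, hb⟩ := this
      have := norm_smul_inv_norm (𝕜 := ℂ) hb
      exact ⟨_, this, by rw [h0, zero_sub, norm_neg, this]; simp⟩
    · refine ⟨((‖j‖ : ℂ)⁻¹) • j, norm_smul_inv_norm h0, ?_⟩
      have hn : (‖j‖ : ℂ) ≠ 0 := by exact_mod_cast norm_ne_zero_iff.mpr h0
      have : j - (‖j‖ : ℂ)⁻¹ • j = ((‖j‖ - 1 : ℝ) : ℂ) • ((‖j‖ : ℂ)⁻¹ • j) := by
        rw [smul_smul]
        push_cast
        rw [sub_mul, mul_inv_cancel₀ hn, sub_smul]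
        simp
      have h1 : ‖(‖j‖ : ℂ)⁻¹ • j‖ = 1 := norm_smul_inv_norm h0
      rw [this, norm_smul, h1, mul_one, Complex.norm_real, Real.norm_eq_abs]
  refine ⟨i, hi, ?_⟩
  have h1 : ‖junkTensor j (graphState G)‖ = ‖j‖ := by
    rw [norm_junkTensor, norm_graphState, mul_one]
  have h2 : |‖j‖ - 1| ≤ ‖Ψ - junkTensor j (graphState G)‖ := by
    rw [← h1, ← hΨ, norm_sub_rev]
    exact abs_norm_sub_norm_le _ _
  have h3 : ‖junkTensor j (graphState G) - junkTensor i (graphState G)‖ = |‖j‖ - 1| := by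
    rw [junkTensor_sub_left, norm_junkTensor, norm_graphState, mul_one, hij]
  have := norm_sub_le_norm_sub_add_norm_sub Ψ (junkTensor j (graphState G))
    (junkTensor i (graphState G))
  linarith

end GraphState

section Qubits

variable {V : Type*} [Fintype V] [DecidableEq V]

theorem HilbertTensor.qubits_tmul (x : V → EuclideanSpace ℂ (Fin 2)) (b : V → Fin 2) :
    (HilbertTensor.qubits V).tmul x b = ∏ v, x v (b v) := by
  simp [qubits, withQubit, qubitMul, scalars]

theorem pauliX_op_apply (x : EuclideanSpace ℂ (Fin 2)) (i : Fin 2) :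
    pauliX.op x i = x (i + 1) := by
  fin_cases i <;> 
    simp [pauliX, qubitObservable, Matrix.ofLp_toEuclideanCLM, Matrix.vecHead, Matrix.vecTail]

theorem pauliZ_op_apply (x : EuclideanSpace ℂ (Fin 2)) (i : Fin 2) :
    pauliZ.op x i = (-1) ^ (i : ℕ) * x i := by
  fin_cases i <;> 
    simp [pauliZ, qubitObservable, Matrix.ofLp_toEuclideanCLM, Matrix.vecHead, Matrix.vecTail]

theorem rot_op (θ : ℝ) : (rot θ).op
    = (Real.cos θ : ℂ) • pauliX.op + (Real.sin θ : ℂ) • pauliZ.op := by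
  simp only [rot, pauliX, pauliZ, qubitObservable, rotMatrix, map_add, map_smul]

theorem qubits_localOp_pauliX (v : V) (φ : EuclideanSpace ℂ (V → Fin 2)) :
    (HilbertTensor.qubits V).localOp v pauliX φ = xFlip v φ := by
  refine DFunLike.congr_fun ((HilbertTensor.qubits V).ext_clm
    (B := (xFlip v).toContinuousLinearMap) fun x => ?_) φ
  ext b
  change _ = (HilbertTensor.qubits V).tmul x (b + Pi.single v 1)
  rw [HilbertTensor.localOp_tmul, HilbertTensor.qubits_tmul, HilbertTensor.qubits_tmul]
  refine Finset.prod_congr rfl fun w _ => ?_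
  by_cases h : w = v
  · subst h; simp [pauliX_op_apply]
  · simp [h]

theorem qubits_zOp (obs : V → MeasBasis → Observable (EuclideanSpace ℂ (Fin 2)))
    (hobs : ∀ v, obs v .Z = pauliZ) (s : Finset V) (φ : EuclideanSpace ℂ (V → Fin 2)) :
    (HilbertTensor.qubits V).zOp obs s φ = zFlip s φ := by
  refine DFunLike.congr_fun ((HilbertTensor.qubits V).ext_clm
    (A := ((HilbertTensor.qubits V).zOp obs s).toContinuousLinearMap)
    (B := (zFlip s).toContinuousLinearMap) fun x => ?_) φ
  ext b
  change (HilbertTensor.qubits V).zOp obs s _ b = zSign s b * (HilbertTensor.qubits V).tmul x b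
  rw [HilbertTensor.zOp, HilbertTensor.queryOp, HilbertTensor.jointOp_tmul,
    HilbertTensor.qubits_tmul, HilbertTensor.qubits_tmul, zSign,
    show ∏ w ∈ s, (-1 : ℂ) ^ (b w : ℕ) = ∏ w, if w ∈ s then (-1 : ℂ) ^ (b w : ℕ) else 1 by simp,
    ← Finset.prod_mul_distrib]
  refine Finset.prod_congr rfl fun w _ => ?_
  by_cases h : w ∈ s
  · simp [h, hobs, pauliZ_op_apply]
  · simp [h, Observable.ident_op_apply]

theorem qubits_localOp_pauliZ (v : V) (φ : EuclideanSpace ℂ (V → Fin 2)) :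
    (HilbertTensor.qubits V).localOp v pauliZ φ = zFlip {v} φ := by
  rw [← qubits_zOp (fun _ => ideal 0) (fun _ => rfl), HilbertTensor.zOp_singleton]
  rfl

theorem HilbertTensor.qubits_localOp_rot (v : V) (θ : ℝ) (φ : EuclideanSpace ℂ (V → Fin 2)) :
    (HilbertTensor.qubits V).localOp v (rot θ) φ
      = (Real.cos θ : ℂ) • (HilbertTensor.qubits V).localOp v pauliX φ
        + (Real.sin θ : ℂ) • (HilbertTensor.qubits V).localOp v pauliZ φ := by
  refine DFunLike.congr_fun ((HilbertTensor.qubits V).ext_clm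
    (A := (HilbertTensor.qubits V).localOp v (rot θ))
    (B := (Real.cos θ : ℂ) • (HilbertTensor.qubits V).localOp v pauliX
      + (Real.sin θ : ℂ) • (HilbertTensor.qubits V).localOp v pauliZ) fun x => ?_) φ
  simp only [add_apply, smul_apply, localOp_tmul, rot_op, MultilinearMap.map_update_add,
    MultilinearMap.map_update_smul]

end Qubits

/-! ### The acceptance probability as a sum of squares -/

section Hilbert

variable {K : Type*} [NormedAddCommGroup K] [InnerProductSpace ℂ K]

theorem re_inner_eq_one_sub {x y : K} (hx : ‖x‖ = 1) (hy : ‖y‖ = 1) :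
    RCLike.re ⟪x, y⟫_ℂ = 1 - ‖y - x‖ ^ 2 / 2 := by
  have := norm_sub_sq (𝕜 := ℂ) x y
  rw [hx, hy, norm_sub_rev] at this
  linarith

theorem neg_re_inner_eq_one_sub {x y : K} (hx : ‖x‖ = 1) (hy : ‖y‖ = 1) :
    -RCLike.re ⟪x, y⟫_ℂ = 1 - ‖y + x‖ ^ 2 / 2 := by
  have := norm_add_sq (𝕜 := ℂ) x y
  rw [hx, hy, add_comm x y] at this
  linarith

/-- The sum-of-squares identity behind the bound for the `R(±θ)` queries: although `a` and `b` need
not be orthogonal, the squared norms of `c a + s b` and `c a - s b` add up to `2`. -/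
theorem sum_re_inner_eq {r : ℤˣ → K} {a b : K} (hr : ∀ t, ‖r t‖ = 1) (ha : ‖a‖ = 1)
    (hb : ‖b‖ = 1) {c s : ℝ} (hcs : c ^ 2 + s ^ 2 = 1) :
    ∑ t : ℤˣ, (c * RCLike.re ⟪r t, a⟫_ℂ + s * (((t : ℤ) : ℝ) * RCLike.re ⟪r t, b⟫_ℂ))
      = 2 - (∑ t : ℤˣ, ‖r t - ((c : ℂ) • a + ((((t : ℤ) : ℝ) * s : ℝ) : ℂ) • b)‖ ^ 2) / 2 := by
  have hin : ∀ t : ℤˣ, ∀ z : K, RCLike.re ⟪z, (c : ℂ) • a + ((((t : ℤ) : ℝ) * s : ℝ) : ℂ) • b⟫_ℂ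
      = c * RCLike.re ⟪z, a⟫_ℂ + s * (((t : ℤ) : ℝ) * RCLike.re ⟪z, b⟫_ℂ) := by
    intro t z
    rw [inner_add_right, inner_smul_right, inner_smul_right]
    simp
    ring
  have hw : ∀ t : ℤˣ, ‖(c : ℂ) • a + ((((t : ℤ) : ℝ) * s : ℝ) : ℂ) • b‖ ^ 2
      = 1 + 2 * ((t : ℤ) : ℝ) * (c * s * RCLike.re ⟪a, b⟫_ℂ) := by
    intro t
    have ht : ((t : ℤ) : ℝ) ^ 2 = 1 := by
      rcases Int.units_eq_one_or t with h | h <;> simp [h]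
    rw [norm_add_sq (𝕜 := ℂ), norm_smul, norm_smul, ha, hb, inner_smul_left,
      inner_smul_right, Complex.norm_real, Complex.norm_real, Real.norm_eq_abs, Real.norm_eq_abs]
    simp only [mul_one, sq_abs]
    simp
    linear_combination hcs + s ^ 2 * ht
  simp only [norm_sub_sq (𝕜 := ℂ), hr, hw, hin]
  rw [show (Finset.univ : Finset ℤˣ) = {1, -1} from rfl, Finset.sum_pair (by decide),
    Finset.sum_pair (by decide)]
  simp
  ring

end Hilbert

namespace OneShotTest

variable {V : Type*} [Fintype V] [DecidableEq V] {G : SimpleGraph V} (𝒯 : OneShotTest G)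

theorem cos_nonneg (v : V) : 0 ≤ Real.cos (𝒯.θ v) :=
  Real.cos_nonneg_of_mem_Icc ⟨by linarith [𝒯.θ_nonneg v, Real.pi_pos], 𝒯.θ_le v⟩

theorem sin_nonneg (v : V) : 0 ≤ Real.sin (𝒯.θ v) :=
  Real.sin_nonneg_of_nonneg_of_le_pi (𝒯.θ_nonneg v) (by linarith [𝒯.θ_le v, Real.pi_pos])

theorem normalizer_eq (v : V) : 𝒯.normalizer v = Real.cos (𝒯.θ v) + Real.sin (𝒯.θ v) := by
  rw [normalizer, abs_of_nonneg (𝒯.sin_nonneg v)]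

theorem normalizer_pos (v : V) : 0 < 𝒯.normalizer v := by
  rw [normalizer_eq]
  nlinarith [𝒯.cos_nonneg v, 𝒯.sin_nonneg v, Real.cos_sq_add_sin_sq (𝒯.θ v)]

theorem normalizer_le (v : V) : 𝒯.normalizer v ≤ 2 := by
  rw [normalizer_eq]
  linarith [Real.cos_le_one (𝒯.θ v), Real.sin_le_one (𝒯.θ v)]

theorem N_pos [Nonempty V] : 0 < 𝒯.N := by
  have : 0 < Fintype.card V := Fintype.card_pos
  unfold N
  positivity

variable [DecidableRel G.Adj] {H : V → Type*} [∀ v, NormedAddCommGroup (H v)]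
  [∀ v, InnerProductSpace ℂ (H v)] [∀ v, CompleteSpace (H v)]
  {K : Type*} [NormedAddCommGroup K] [InnerProductSpace ℂ K] [CompleteSpace K]
  (T : HilbertTensor H K) (ψ : K) (obs : ∀ v, MeasBasis → Observable (H v))

/-- The vector `(cos θ_v Z^{A 1_v} + t sin θ_v X_u Z^{A 1_u ⊕ 1_v}) ψ`, which optimal provers
share with `R_v(t θ_v) ψ`. -/
noncomputable def rTarget (v : V) (t : ℤˣ) : K :=
  (Real.cos (𝒯.θ v) : ℂ) • T.zOp obs (G.neighborFinset v) ψ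
    + ((((t : ℤ) : ℝ) * Real.sin (𝒯.θ v) : ℝ) : ℂ) • T.localOp (𝒯.nbr v) (obs (𝒯.nbr v) .X)
      (T.zOp obs ((G.neighborFinset (𝒯.nbr v)).erase v) ψ)

/-- The weighted sum of the squared violations of the relations that the test checks. -/
noncomputable def deviation : ℝ :=
  ∑ v, ‖T.queryOp obs (vertexQuery G v) ψ - ψ‖ ^ 2
  + ∑ τ ∈ 𝒯.triangles, ‖T.queryOp obs (triangleQuery G τ) ψ + ψ‖ ^ 2
  + ∑ v, (∑ t : ℤˣ, ‖T.localOp v (obs v (.R t)) ψ - 𝒯.rTarget T ψ obs v t‖ ^ 2) / 𝒯.normalizer v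

theorem rDeviation_nonneg :
    0 ≤ ∑ v, (∑ t : ℤˣ, ‖T.localOp v (obs v (.R t)) ψ - 𝒯.rTarget T ψ obs v t‖ ^ 2)
      / 𝒯.normalizer v :=
  Finset.sum_nonneg fun v _ =>
    div_nonneg (Finset.sum_nonneg fun _ _ => sq_nonneg _) (𝒯.normalizer_pos v).le

theorem deviation_nonneg : 0 ≤ 𝒯.deviation T ψ obs :=
  add_nonneg (by positivity) (𝒯.rDeviation_nonneg T ψ obs)

variable {ψ}

/-- The expected score of the two `RTHETA` queries at `v`. -/
theorem sum_rScore (hψ : ‖ψ‖ = 1) (v : V) :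
    ∑ t : ℤˣ,
      (Real.cos (𝒯.θ v) / 𝒯.normalizer v
        * ((1 + ((1 : ℤˣ) : ℤ) * RCLike.re ⟪ψ, T.queryOp obs (rxQuery G v t) ψ⟫_ℂ) / 2)
      + |Real.sin (𝒯.θ v)| / 𝒯.normalizer v
        * ((1 + ((t : ℤ) : ℝ)
          * RCLike.re ⟪ψ, T.queryOp obs (rzQuery G v (𝒯.nbr v) t) ψ⟫_ℂ) / 2))
      = 1 + 1 / 𝒯.normalizer v
        - (∑ t : ℤˣ, ‖T.localOp v (obs v (.R t)) ψ - 𝒯.rTarget T ψ obs v t‖ ^ 2)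
          / 𝒯.normalizer v / 4 := by
  have hn := (𝒯.normalizer_pos v).ne'
  have key := sum_re_inner_eq (r := fun t => T.localOp v (obs v (.R t)) ψ)
    (a := T.zOp obs (G.neighborFinset v) ψ)
    (b := T.localOp (𝒯.nbr v) (obs (𝒯.nbr v) .X)
      (T.zOp obs ((G.neighborFinset (𝒯.nbr v)).erase v) ψ))
    (fun t => by rw [T.norm_localOp, hψ]) (by rw [LinearIsometry.norm_map, hψ])
    (by rw [T.norm_localOp, LinearIsometry.norm_map, hψ]) (Real.cos_sq_add_sin_sq (𝒯.θ v))
  simp only [T.inner_localOp_left, ← T.queryOp_rxQuery,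
    ← T.queryOp_rzQuery obs G (𝒯.adj_nbr v).ne'] at key
  have hsum : ∀ f g : ℤˣ → ℝ, ∑ t, (Real.cos (𝒯.θ v) / 𝒯.normalizer v
        * ((1 + ((1 : ℤˣ) : ℤ) * f t) / 2)
      + |Real.sin (𝒯.θ v)| / 𝒯.normalizer v * ((1 + ((t : ℤ) : ℝ) * g t) / 2))
      = 1 + (∑ t, (Real.cos (𝒯.θ v) * f t + Real.sin (𝒯.θ v) * (((t : ℤ) : ℝ) * g t)))
        / 𝒯.normalizer v / 2 := by
    intro f g
    rw [abs_of_nonneg (𝒯.sin_nonneg v), show (Finset.univ : Finset ℤˣ) = {1, -1} from rfl,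
      Finset.sum_pair (by decide), Finset.sum_pair (by decide)]
    simp only [Units.val_one, Units.val_neg, Int.cast_one, Int.cast_neg]
    field_simp
    rw [normalizer_eq]
    ring
  rw [hsum, key]
  simp only [rTarget]
  ring

/-- The test loses exactly the squared violations of the relations. -/
theorem acceptProb_eq [Nonempty V] (hψ : ‖ψ‖ = 1) :
    𝒯.acceptProb T ψ obs = 𝒯.cTest - 𝒯.deviation T ψ obs / (4 * 𝒯.N) := by
  have hN := 𝒯.N_pos.ne'
  have hV : (Fintype.card V : ℝ) ≠ 0 := by exact_mod_cast Fintype.card_ne_zero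
  have hT : (𝒯.triangles.card : ℝ) ≠ 0 := by
    obtain ⟨τ, hτ, -⟩ := 𝒯.cover (Classical.arbitrary V)
    exact_mod_cast (Finset.card_pos.mpr ⟨τ, hτ⟩).ne'
  have hU : (Fintype.card ℤˣ : ℝ) = 2 := by norm_num
  have hq : 𝒯.acceptProb T ψ obs = 𝒯.acceptWith fun q σ =>
      (1 + ((σ : ℤ) : ℝ) * RCLike.re ⟪ψ, T.queryOp obs q ψ⟫_ℂ) / 2 :=
    congrArg 𝒯.acceptWith (funext fun q => funext fun σ => T.productProb_eq hψ _ σ)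
  have h1 : ∀ v, (1 + (((1 : ℤˣ) : ℤ) : ℝ)
      * RCLike.re ⟪ψ, T.queryOp obs (vertexQuery G v) ψ⟫_ℂ) / 2
      = 1 - ‖T.queryOp obs (vertexQuery G v) ψ - ψ‖ ^ 2 / 4 := by
    intro v
    rw [re_inner_eq_one_sub hψ (by rw [LinearIsometry.norm_map, hψ])]
    push_cast
    ring
  have h2 : ∀ τ, (1 + (((-1 : ℤˣ) : ℤ) : ℝ)
      * RCLike.re ⟪ψ, T.queryOp obs (triangleQuery G τ) ψ⟫_ℂ) / 2
      = 1 - ‖T.queryOp obs (triangleQuery G τ) ψ + ψ‖ ^ 2 / 4 := by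
    intro τ
    have := neg_re_inner_eq_one_sub hψ
      ((LinearIsometry.norm_map (T.queryOp obs (triangleQuery G τ)) ψ).trans hψ)
    push_cast
    linarith
  rw [hq, acceptWith]
  simp only [h1, h2, Finset.expect_eq_sum_div_card, ← Finset.sum_div]
  rw [Finset.sum_comm]
  simp only [𝒯.sum_rScore T obs hψ, Finset.sum_add_distrib, Finset.sum_sub_distrib,
    ← Finset.sum_div, Finset.card_univ, hU, Finset.sum_const, nsmul_eq_mul, mul_one]
  unfold cTest deviation
  field_simp
  ring

theorem acceptProb_le [Nonempty V] (hψ : ‖ψ‖ = 1) : 𝒯.acceptProb T ψ obs ≤ 𝒯.cTest := by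
  rw [𝒯.acceptProb_eq T obs hψ]
  have h1 := 𝒯.N_pos
  have h2 := 𝒯.deviation_nonneg T ψ obs
  have : 0 ≤ 𝒯.deviation T ψ obs / (4 * 𝒯.N) := by positivity
  linarith

section Bounds

variable (ψ)

theorem norm_vertex_le (v : V) :
    ‖T.queryOp obs (vertexQuery G v) ψ - ψ‖ ≤ Real.sqrt (𝒯.deviation T ψ obs) := by
  refine Real.le_sqrt_of_sq_le ?_
  have h1 := Finset.single_le_sum (f := fun v => ‖T.queryOp obs (vertexQuery G v) ψ - ψ‖ ^ 2)
    (fun _ _ => by positivity) (Finset.mem_univ v)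
  have h2 : 0 ≤ ∑ τ ∈ 𝒯.triangles, ‖T.queryOp obs (triangleQuery G τ) ψ + ψ‖ ^ 2 := by positivity
  have h3 := 𝒯.rDeviation_nonneg T ψ obs
  unfold deviation
  linarith

theorem norm_triangle_le {τ : Finset V} (hτ : τ ∈ 𝒯.triangles) :
    ‖T.queryOp obs (triangleQuery G τ) ψ + ψ‖ ≤ Real.sqrt (𝒯.deviation T ψ obs) := by
  refine Real.le_sqrt_of_sq_le ?_
  have h1 := Finset.single_le_sum (f := fun τ => ‖T.queryOp obs (triangleQuery G τ) ψ + ψ‖ ^ 2)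
    (fun _ _ => by positivity) hτ
  have h2 : 0 ≤ ∑ v, ‖T.queryOp obs (vertexQuery G v) ψ - ψ‖ ^ 2 := by positivity
  have h3 := 𝒯.rDeviation_nonneg T ψ obs
  unfold deviation
  linarith

theorem norm_localOp_R_sub_rTarget_le (v : V) (t : ℤˣ) :
    ‖T.localOp v (obs v (.R t)) ψ - 𝒯.rTarget T ψ obs v t‖
      ≤ 2 * Real.sqrt (𝒯.deviation T ψ obs) := by
  have hp := 𝒯.normalizer_pos
  set f : V → ℤˣ → ℝ := fun v t =>
    ‖T.localOp v (obs v (.R t)) ψ - 𝒯.rTarget T ψ obs v t‖ ^ 2 with hf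
  have h0 : f v t ≤ ∑ t, f v t :=
    Finset.single_le_sum (f := f v) (fun _ _ => by positivity) (Finset.mem_univ t)
  have h1 : (∑ t, f v t) / 𝒯.normalizer v ≤ ∑ v, (∑ t, f v t) / 𝒯.normalizer v :=
    Finset.single_le_sum (f := fun v => (∑ t, f v t) / 𝒯.normalizer v)
      (fun w _ => by have := hp w; positivity) (Finset.mem_univ v)
  have h2 : 0 ≤ ∑ v, ‖T.queryOp obs (vertexQuery G v) ψ - ψ‖ ^ 2 := by positivity
  have h3 : 0 ≤ ∑ τ ∈ 𝒯.triangles, ‖T.queryOp obs (triangleQuery G τ) ψ + ψ‖ ^ 2 := by positivity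
  have h4 : (∑ t, f v t) / 𝒯.normalizer v ≤ 𝒯.deviation T ψ obs := by
    unfold deviation
    linarith
  rw [div_le_iff₀ (hp v)] at h4
  have h5 := mul_le_mul_of_nonneg_left (𝒯.normalizer_le v) (𝒯.deviation_nonneg T ψ obs)
  have h6 := Real.sq_sqrt (𝒯.deviation_nonneg T ψ obs)
  refine le_of_sq_le_sq ?_ (by positivity)
  change f v t ≤ _
  nlinarith [𝒯.deviation_nonneg T ψ obs]

end Bounds

end OneShotTest

/-! ### The state and the observables after the swap isometry -/

theorem norm_smul_add_smul_le {E : Type*} [NormedAddCommGroup E] [NormedSpace ℂ E] {x y : E}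
    {c s : ℂ} {p q : ℝ} (hc : ‖c‖ ≤ 1) (hs : ‖s‖ ≤ 1) (hx : ‖x‖ ≤ p) (hy : ‖y‖ ≤ q) :
    ‖c • x + s • y‖ ≤ p + q := by
  refine (norm_add_le _ _).trans (add_le_add ?_ ?_)
  · rw [norm_smul]
    exact (mul_le_of_le_one_left (norm_nonneg _) hc).trans hx
  · rw [norm_smul]
    exact (mul_le_of_le_one_left (norm_nonneg _) hs).trans hy

namespace OneShotTest

variable {V : Type*} [Fintype V] [DecidableEq V] {G : SimpleGraph V} [DecidableRel G.Adj]
  (𝒯 : OneShotTest G) {H : V → Type*} [∀ v, NormedAddCommGroup (H v)]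
  [∀ v, InnerProductSpace ℂ (H v)] [∀ v, CompleteSpace (H v)]
  {K : Type*} [NormedAddCommGroup K] [InnerProductSpace ℂ K] [CompleteSpace K]
  (T : HilbertTensor H K) (ψ : K) (obs : ∀ v, MeasBasis → Observable (H v))

omit [DecidableRel G.Adj] in
theorem exists_triangle (v : V) :
    ∃ a c, G.Adj v a ∧ G.Adj v c ∧ G.Adj a c ∧ ({v, a, c} : Finset V) ∈ 𝒯.triangles := by
  obtain ⟨τ, hτ, hv⟩ := 𝒯.cover v
  obtain ⟨x, y, z, hxy, hxz, hyz, rfl⟩ := SimpleGraph.is3Clique_iff.mp (𝒯.isTriangle τ hτ)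
  simp only [Finset.mem_insert, Finset.mem_singleton] at hv
  rcases hv with rfl | rfl | rfl
  · exact ⟨y, z, hxy, hxz, hyz, hτ⟩
  · exact ⟨x, z, hxy.symm, hyz, hxz, by rwa [Finset.insert_comm]⟩
  · refine ⟨x, y, hxz.symm, hyz.symm, hxy, ?_⟩
    convert hτ using 1
    ext w
    simp only [Finset.mem_insert, Finset.mem_singleton]
    tauto

/-- Walking around a triangle through `v` uses four relations, each of which holds up to the square
root of the deviation. -/
theorem norm_anticommutator_le (v : V) :
    ‖T.localOp v (obs v .X) (T.localOp v (obs v .Z) ψ)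
      + T.localOp v (obs v .Z) (T.localOp v (obs v .X) ψ)‖
      ≤ 4 * Real.sqrt (𝒯.deviation T ψ obs) := by
  obtain ⟨a, c, hva, hvc, hac, hτ⟩ := 𝒯.exists_triangle v
  have hcomp : ∀ (U : K →ₗᵢ[ℂ] K) (x y : K), ‖U x + y‖ ≤ ‖x - ψ‖ + ‖U ψ + y‖ := by
    intro U x y
    rw [← U.norm_map (x - ψ), map_sub]
    refine (norm_add_le _ _).trans' (le_of_eq ?_)
    congr 1
    abel
  have hq := T.queryOp_triangleQuery obs G hva hvc hac ψ
  set D := Real.sqrt (𝒯.deviation T ψ obs)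
  have h1 : ‖T.queryOp obs (vertexQuery G v) (T.queryOp obs (vertexQuery G c) ψ) - ψ‖
      ≤ D + D := by
    rw [sub_eq_add_neg]
    refine (hcomp _ _ _).trans (add_le_add (𝒯.norm_vertex_le T ψ obs c) ?_)
    rw [← sub_eq_add_neg]
    exact 𝒯.norm_vertex_le T ψ obs v
  have h2 : ‖T.queryOp obs (vertexQuery G a) (T.queryOp obs (vertexQuery G v)
      (T.queryOp obs (vertexQuery G c) ψ)) - ψ‖ ≤ D + D + D := by
    rw [sub_eq_add_neg]
    refine (hcomp _ _ _).trans (add_le_add h1 ?_)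
    rw [← sub_eq_add_neg]
    exact 𝒯.norm_vertex_le T ψ obs a
  have h3 := (hcomp (T.queryOp obs (triangleQuery G {v, a, c})) (T.queryOp obs (vertexQuery G a)
    (T.queryOp obs (vertexQuery G v) (T.queryOp obs (vertexQuery G c) ψ))) ψ).trans
      (add_le_add h2 (𝒯.norm_triangle_le T ψ obs hτ))
  rw [hq, ← T.norm_localOp v (obs v .X), ← T.norm_localOp v (obs v .Z), map_add, map_add,
    T.localOp_localOp, T.localOp_localOp] at h3
  linarith

theorem norm_swap_localOp_X_sub_le (v : V) :
    ‖T.swap (fun v => obs v .X) (fun v => obs v .Z) (T.localOp v (obs v .X) ψ)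
      - xFlip v (T.swap (fun v => obs v .X) (fun v => obs v .Z) ψ)‖
      ≤ 3 * Real.sqrt (𝒯.deviation T ψ obs) := by
  -- The anticommutator enters with the factor `1 / √2`, and `4 / √2 ≤ 3`.
  have h2 : 4 / 3 ≤ Real.sqrt 2 := Real.le_sqrt_of_sq_le (by norm_num)
  rw [T.norm_swap_localOp_X_sub (fun v => obs v .X), inv_mul_le_iff₀ (by positivity)]
  refine (𝒯.norm_anticommutator_le T ψ obs v).trans ?_
  nlinarith [Real.sqrt_nonneg (𝒯.deviation T ψ obs)]

theorem norm_zOp_sub_localOp_X_le (v : V) :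
    ‖T.zOp obs (G.neighborFinset v) ψ - T.localOp v (obs v .X) ψ‖
      ≤ Real.sqrt (𝒯.deviation T ψ obs) := by
  rw [← T.norm_localOp v (obs v .X), map_sub, T.localOp_localOp, ← T.queryOp_vertexQuery]
  exact 𝒯.norm_vertex_le T ψ obs v

theorem norm_localOp_nbr_sub_localOp_Z_le (v : V) :
    ‖T.localOp (𝒯.nbr v) (obs (𝒯.nbr v) .X)
        (T.zOp obs ((G.neighborFinset (𝒯.nbr v)).erase v) ψ) - T.localOp v (obs v .Z) ψ‖
      ≤ Real.sqrt (𝒯.deviation T ψ obs) := by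
  rw [← T.norm_localOp v (obs v .Z), map_sub, T.localOp_localOp,
    ← T.queryOp_vertexQuery_of_adj obs G (𝒯.adj_nbr v).symm]
  exact 𝒯.norm_vertex_le T ψ obs (𝒯.nbr v)

/-- The image of the state under the swap isometry is almost fixed by the stabilizers of the graph
state. -/
theorem norm_swap_stabilizer_sub_le (v : V) :
    ‖zFlip (G.neighborFinset v) (xFlip v (T.swap (fun v => obs v .X) (fun v => obs v .Z) ψ))
      - T.swap (fun v => obs v .X) (fun v => obs v .Z) ψ‖
      ≤ 4 * Real.sqrt (𝒯.deviation T ψ obs) := by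
  set Φ := T.swap (fun v => obs v .X) (fun v => obs v .Z) with hΦ
  set D := Real.sqrt (𝒯.deviation T ψ obs)
  have h0 : zFlip (G.neighborFinset v) (zFlip (G.neighborFinset v) (Φ ψ)) = Φ ψ := by
    ext1 b
    rw [zFlip_apply, zFlip_apply, smul_smul, zSign_mul_self, one_smul]
  have h1 : ‖zFlip (G.neighborFinset v) (xFlip v (Φ ψ)) - Φ ψ‖
      = ‖xFlip v (Φ ψ) - Φ (T.zOp obs (G.neighborFinset v) ψ)‖ := by
    nth_rewrite 2 [← h0]
    rw [← map_sub, LinearIsometry.norm_map, hΦ, T.swap_zOp]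
  have h2 := norm_sub_le_norm_sub_add_norm_sub (xFlip v (Φ ψ)) (Φ (T.localOp v (obs v .X) ψ))
    (Φ (T.zOp obs (G.neighborFinset v) ψ))
  have h3 : ‖xFlip v (Φ ψ) - Φ (T.localOp v (obs v .X) ψ)‖ ≤ 3 * D := by
    rw [norm_sub_rev]
    exact 𝒯.norm_swap_localOp_X_sub_le T ψ obs v
  have h4 : ‖Φ (T.localOp v (obs v .X) ψ) - Φ (T.zOp obs (G.neighborFinset v) ψ)‖ ≤ D := by
    rw [← map_sub, LinearIsometry.norm_map, norm_sub_rev]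
    exact 𝒯.norm_zOp_sub_localOp_X_le T ψ obs v
  linarith

/-- Once the state itself is mapped close to `j ⊗ |G⟩`, so are its images under the observables. -/
theorem norm_swap_localOp_sub_junkTensor_le (j : PiLp 2 fun _ : V → Fin 2 => K)
    (v : V) (M : MeasBasis) :
    ‖T.swap (fun v => obs v .X) (fun v => obs v .Z) (T.localOp v (obs v M) ψ)
      - junkTensor j ((HilbertTensor.qubits V).localOp v (ideal (𝒯.θ v) M) (graphState G))‖
      ≤ 7 * Real.sqrt (𝒯.deviation T ψ obs)
        + 2 * ‖T.swap (fun v => obs v .X) (fun v => obs v .Z) ψ - junkTensor j (graphState G)‖ := by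
  set Φ := T.swap (fun v => obs v .X) (fun v => obs v .Z) with hΦ
  set D := Real.sqrt (𝒯.deviation T ψ obs) with hD
  have hD0 : 0 ≤ D := Real.sqrt_nonneg _
  set d := ‖Φ ψ - junkTensor j (graphState G)‖ with hd
  have hd0 : 0 ≤ d := norm_nonneg _
  have hX : ‖Φ (T.localOp v (obs v .X) ψ)
      - junkTensor j ((HilbertTensor.qubits V).localOp v pauliX (graphState G))‖ ≤ 3 * D + d := by
    rw [qubits_localOp_pauliX, junkTensor_xFlip, hd, ← (xFlip v).norm_map (Φ ψ - _), map_sub]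
    exact (norm_sub_le_norm_sub_add_norm_sub _ (xFlip v (Φ ψ)) _).trans
      (add_le_add (𝒯.norm_swap_localOp_X_sub_le T ψ obs v) le_rfl)
  have hZ : ‖Φ (T.localOp v (obs v .Z) ψ)
      - junkTensor j ((HilbertTensor.qubits V).localOp v pauliZ (graphState G))‖ = d := by
    rw [qubits_localOp_pauliZ, junkTensor_zFlip, ← T.zOp_singleton, hΦ, T.swap_zOp, ← map_sub,
      LinearIsometry.norm_map]
  cases M with
  | X => exact hX.trans (by linarith)
  | Z => exact hZ.le.trans (by linarith)
  | R t =>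
    set c := Real.cos (𝒯.θ v)
    set s := ((t : ℤ) : ℝ) * Real.sin (𝒯.θ v) with hs
    have hrot : ideal (𝒯.θ v) (.R t) = rot (((t : ℤ) : ℝ) * 𝒯.θ v) := rfl
    have hcos : Real.cos (((t : ℤ) : ℝ) * 𝒯.θ v) = c := by
      rcases Int.units_eq_one_or t with h | h <;> simp [h, c]
    have hsin : Real.sin (((t : ℤ) : ℝ) * 𝒯.θ v) = s := by
      rcases Int.units_eq_one_or t with h | h <;> simp [h, s]
    have hc1 : ‖(c : ℂ)‖ ≤ 1 := by
      rw [Complex.norm_real]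
      exact Real.abs_cos_le_one _
    have hs1 : ‖(s : ℂ)‖ ≤ 1 := by
      rw [Complex.norm_real, ← hsin]
      exact Real.abs_sin_le_one _
    -- `R ψ` is close to `rTarget`, hence to `(c X + s Z) ψ`, whose image is close to the ideal one.
    have h1 := 𝒯.norm_localOp_R_sub_rTarget_le T ψ obs v t
    have h2 : ‖𝒯.rTarget T ψ obs v t - ((c : ℂ) • T.localOp v (obs v .X) ψ
        + (s : ℂ) • T.localOp v (obs v .Z) ψ)‖ ≤ D + D := by
      rw [rTarget, add_sub_add_comm, ← smul_sub, ← smul_sub]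
      exact norm_smul_add_smul_le hc1 hs1 (𝒯.norm_zOp_sub_localOp_X_le T ψ obs v)
        (𝒯.norm_localOp_nbr_sub_localOp_Z_le T ψ obs v)
    have h3 := norm_smul_add_smul_le hc1 hs1 hX hZ.le
    have h4 := norm_sub_le_norm_sub_add_norm_sub (T.localOp v (obs v (.R t)) ψ)
      (𝒯.rTarget T ψ obs v t)
      ((c : ℂ) • T.localOp v (obs v .X) ψ + (s : ℂ) • T.localOp v (obs v .Z) ψ)
    rw [← Φ.norm_map (T.localOp v (obs v (.R t)) ψ - _), map_sub] at h4
    have h5 : Φ ((c : ℂ) • T.localOp v (obs v .X) ψ + (s : ℂ) • T.localOp v (obs v .Z) ψ)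
        - junkTensor j ((HilbertTensor.qubits V).localOp v (ideal (𝒯.θ v) (.R t)) (graphState G))
        = (c : ℂ) • (Φ (T.localOp v (obs v .X) ψ)
          - junkTensor j ((HilbertTensor.qubits V).localOp v pauliX (graphState G)))
        + (s : ℂ) • (Φ (T.localOp v (obs v .Z) ψ)
          - junkTensor j ((HilbertTensor.qubits V).localOp v pauliZ (graphState G))) := by
      rw [hrot, HilbertTensor.qubits_localOp_rot, hcos, hsin, map_add, map_smul, map_smul]
      ext1 b
      simp only [PiLp.sub_apply, PiLp.add_apply, PiLp.smul_apply, junkTensor_apply, smul_eq_mul]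
      module
    have h6 := norm_sub_le_norm_sub_add_norm_sub (Φ (T.localOp v (obs v (.R t)) ψ))
      (Φ ((c : ℂ) • T.localOp v (obs v .X) ψ + (s : ℂ) • T.localOp v (obs v .Z) ψ))
      (junkTensor j ((HilbertTensor.qubits V).localOp v (ideal (𝒯.θ v) (.R t)) (graphState G)))
    rw [h5] at h6
    linarith

end OneShotTest

/-! ### Honest provers -/

/-- The honest provers satisfy all the relations that the test checks. -/
theorem OneShotTest.deviation_honest {V : Type*} [Fintype V] [DecidableEq V] {G : SimpleGraph V}
    [DecidableRel G.Adj] (𝒯 : OneShotTest G) :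
    𝒯.deviation (HilbertTensor.qubits V) (graphState G) (fun v => ideal (𝒯.θ v)) = 0 := by
  set Q := HilbertTensor.qubits V
  set obs : V → MeasBasis → Observable (EuclideanSpace ℂ (Fin 2)) := fun v => ideal (𝒯.θ v)
  have hS : ∀ v, Q.queryOp obs (vertexQuery G v) (graphState G) = graphState G := by
    intro v
    rw [Q.queryOp_vertexQuery, qubits_zOp obs (fun _ => rfl)]
    exact (qubits_localOp_pauliX v _).trans (xFlip_zFlip_graphState G v)
  have hT : ∀ τ ∈ 𝒯.triangles,
      Q.queryOp obs (triangleQuery G τ) (graphState G) = -graphState G := by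
    intro τ hτ
    obtain ⟨v, a, c, hva, hvc, hac, rfl⟩ := SimpleGraph.is3Clique_iff.mp (𝒯.isTriangle τ hτ)
    have h := Q.queryOp_triangleQuery obs G hva hvc hac (graphState G)
    rw [hS, hS, hS] at h
    rw [h]
    have hX : ∀ φ, Q.localOp v (obs v .X) φ = xFlip v φ := qubits_localOp_pauliX v
    have hZ : ∀ φ, Q.localOp v (obs v .Z) φ = zFlip {v} φ := qubits_localOp_pauliZ v
    rw [hX, hX, hZ, hZ]
    ext1 b
    rcases (by decide : ∀ z : Fin 2, z = 0 ∨ z = 1) (b v) with h | h <;>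
      simp [xShift_apply, zFlip_apply, zSign, add_assoc, ← Pi.single_add, h]
  have hR : ∀ v t, Q.localOp v (obs v (.R t)) (graphState G)
      = 𝒯.rTarget Q (graphState G) obs v t := by
    intro v t
    have h1 : Q.zOp obs (G.neighborFinset v) (graphState G)
        = Q.localOp v pauliX (graphState G) := by
      conv_rhs => rw [← hS v, Q.queryOp_vertexQuery]
      exact (Q.localOp_localOp v _ _).symm
    have h2 : Q.localOp (𝒯.nbr v) (obs (𝒯.nbr v) .X)
        (Q.zOp obs ((G.neighborFinset (𝒯.nbr v)).erase v) (graphState G))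
        = Q.localOp v pauliZ (graphState G) := by
      conv_rhs => rw [← hS (𝒯.nbr v), Q.queryOp_vertexQuery_of_adj obs G (𝒯.adj_nbr v).symm]
      exact (Q.localOp_localOp v _ _).symm
    rw [OneShotTest.rTarget, h1, h2]
    refine (HilbertTensor.qubits_localOp_rot v _ _).trans ?_
    rcases Int.units_eq_one_or t with h | h <;> simp [h, Q]
  have hT' : ∑ τ ∈ 𝒯.triangles,
      ‖Q.queryOp obs (triangleQuery G τ) (graphState G) + graphState G‖ ^ 2 = 0 :=
    Finset.sum_eq_zero fun τ hτ => by rw [hT τ hτ]; simp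
  simp [OneShotTest.deviation, hS, hR, hT']

/-! ### Optimality and robustness -/

/-- Distances of size `O(n √D)` between unit vectors satisfy the bound of the self-test. -/
theorem pow_four_le_of_lt {δ e D : ℝ} {n : ℕ} (hδ : 0 ≤ δ) (hD : 0 ≤ D) (hn : 0 < n)
    (hlt : δ < e) (he : e ≤ 2) (heD : e ≤ 23 * n * Real.sqrt D) :
    (δ ^ 2 / (22 + 25 * Real.sqrt n)) ^ 4 ≤ D / 2 := by
  have hn' : (0 : ℝ) < n := by exact_mod_cast hn
  have he0 : 0 ≤ e := hδ.trans hlt.le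
  have h1 : (625 * n) ^ 2 ≤ (22 + 25 * Real.sqrt n) ^ 4 := by
    have hs := Real.sq_sqrt hn'.le
    have : 625 * n ≤ (22 + 25 * Real.sqrt n) ^ 2 := by
      nlinarith [Real.sqrt_nonneg (n : ℝ)]
    calc (625 * (n : ℝ)) ^ 2 ≤ ((22 + 25 * Real.sqrt n) ^ 2) ^ 2 := by gcongr
      _ = _ := by ring
  -- Six of the eight powers of `e` are bounded by powers of `2`, the other two by the bound in `D`.
  have h2 : δ ^ 8 ≤ 64 * (23 * n * Real.sqrt D) ^ 2 := by
    calc δ ^ 8 ≤ e ^ 8 := by gcongr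
      _ = e ^ 6 * e ^ 2 := by ring
      _ ≤ 2 ^ 6 * (23 * n * Real.sqrt D) ^ 2 := by gcongr
      _ = _ := by norm_num
  rw [mul_pow, Real.sq_sqrt hD] at h2
  rw [div_pow, div_le_iff₀ (by positivity), ← pow_mul]
  calc δ ^ (2 * 4) ≤ 64 * ((23 * n) ^ 2 * D) := h2
    _ ≤ D / 2 * (625 * n) ^ 2 := by nlinarith [mul_nonneg hD (sq_nonneg (n : ℝ))]
    _ ≤ _ := by gcongr

theorem mainTheorem6 {V : Type*} [Fintype V] [DecidableEq V] [Nonempty V]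
    (G : SimpleGraph V) [DecidableRel G.Adj] :
    (∀ 𝒯 : OneShotTest G,
      𝒯.acceptProb (HilbertTensor.qubits V) (graphState G) (fun v => ideal (𝒯.θ v)) = 𝒯.cTest) ∧
    ∀ {H : V → Type*} [∀ v, NormedAddCommGroup (H v)] [∀ v, InnerProductSpace ℂ (H v)]
      [∀ v, CompleteSpace (H v)]
      {K : Type*} [NormedAddCommGroup K] [InnerProductSpace ℂ K] [CompleteSpace K]
      (T : HilbertTensor H K) (ψ : K) (_ : ‖ψ‖ = 1) (X Z : ∀ v, Observable (H v)),
      (∀ (𝒯 : OneShotTest G) (R : ∀ v, ℤˣ → Observable (H v)),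
        𝒯.acceptProb T ψ (fun v => answer (X v) (Z v) (R v)) ≤ 𝒯.cTest) ∧
      ∃ (Φ : ∀ v, H v →ₗᵢ[ℂ] PiLp 2 fun _ : Fin 2 => PiLp 2 fun _ : Fin 2 => H v)
        (junk : PiLp 2 fun _ : V → Fin 2 => K), ‖junk‖ = 1 ∧
        ∀ (𝒯 : OneShotTest G) (R : ∀ v, ℤˣ → Observable (H v)) (δ : ℝ), 0 ≤ δ →
          (∃ (v : V) (M : MeasBasis),
            δ < ‖T.map T.withQubit.withQubit Φ
                  (T.localOp v (answer (X v) (Z v) (R v) M) ψ)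
                - junkTensor junk
                  ((HilbertTensor.qubits V).localOp v (ideal (𝒯.θ v) M) (graphState G))‖) →
          𝒯.acceptProb T ψ (fun v => answer (X v) (Z v) (R v)) ≤
            𝒯.cTest - 1 / (2 * 𝒯.N)
              * (δ ^ 2 / (22 + 25 * Real.sqrt (Fintype.card V))) ^ 4 := by
  refine ⟨fun 𝒯 => ?_, ?_⟩
  · rw [𝒯.acceptProb_eq _ _ (norm_graphState G), 𝒯.deviation_honest, zero_div, sub_zero]
  intro H _ _ _ K _ _ _ T ψ hψ X Z
  refine ⟨fun 𝒯 R => 𝒯.acceptProb_le T _ hψ, ?_⟩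
  obtain ⟨j, hj, hjd⟩ := exists_unit_norm_sub_junkTensor_le G (T.swap X Z ψ)
    ((LinearIsometry.norm_map _ _).trans hψ)
  refine ⟨fun v => swapIsometry (X v) (Z v), j, hj, fun 𝒯 R δ hδ ⟨v, M, hM⟩ => ?_⟩
  set obs : ∀ v, MeasBasis → Observable (H v) := fun v => answer (X v) (Z v) (R v)
  have hN := 𝒯.N_pos
  have hD := 𝒯.deviation_nonneg T ψ obs
  have hn : (1 : ℝ) ≤ Fintype.card V := by exact_mod_cast Fintype.card_pos (α := V)
  have hS : ∑ v, ‖zFlip (G.neighborFinset v) (xFlip v (T.swap X Z ψ)) - T.swap X Z ψ‖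
      ≤ Fintype.card V * (4 * Real.sqrt (𝒯.deviation T ψ obs)) := by
    refine (Finset.sum_le_card_nsmul _ _ _ fun v _ =>
      𝒯.norm_swap_stabilizer_sub_le T ψ obs v).trans ?_
    rw [nsmul_eq_mul, Finset.card_univ]
  have hle := 𝒯.norm_swap_localOp_sub_junkTensor_le T ψ obs j v M
  have hle2 : ‖T.swap X Z (T.localOp v (obs v M) ψ)
      - junkTensor j ((HilbertTensor.qubits V).localOp v (ideal (𝒯.θ v) M) (graphState G))‖
      ≤ 2 := by
    refine (norm_sub_le _ _).trans ?_
    rw [LinearIsometry.norm_map, T.norm_localOp, hψ, norm_junkTensor, hj,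
      HilbertTensor.norm_localOp, norm_graphState]
    norm_num
  have key := pow_four_le_of_lt (n := Fintype.card V) hδ hD Fintype.card_pos hM hle2 (by
    have hj' : ‖T.swap (fun v => obs v .X) (fun v => obs v .Z) ψ - junkTensor j (graphState G)‖
        ≤ 2 * (Fintype.card V * (4 * Real.sqrt (𝒯.deviation T ψ obs))) :=
      hjd.trans (by gcongr)
    have hn' := mul_le_mul_of_nonneg_right hn (Real.sqrt_nonneg (𝒯.deviation T ψ obs))
    refine hle.trans ?_
    linarith)
  rw [𝒯.acceptProb_eq T obs hψ]
  have : 1 / (2 * 𝒯.N) * (δ ^ 2 / (22 + 25 * Real.sqrt (Fintype.card V))) ^ 4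
      ≤ 𝒯.deviation T ψ obs / (4 * 𝒯.N) := by
    calc _ ≤ 1 / (2 * 𝒯.N) * (𝒯.deviation T ψ obs / 2) := by gcongr
      _ = _ := by field_simp; ring
  linarith
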